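/- **Theorem 4.3.** Let $L$ be a finite relational language (all relation symbols $R_i$ having positive arity) that contains a ternary relation symbol. For a finite $L$-structure $A$ put $\delta(A)=|A|-\sum_i|R_i[A]|$, where $R_i[A]$ is the set of tuples of elements of $A$ satisfying $R_i$; for finite $L$-structures $A\subseteq B$ write $A\le B$ if $\delta(A)<\delta(B')$ for all $A\subsetneq B'\subseteq B$, and for an arbitrary $L$-structure $M$ and $A\subseteq M$ write $A\le M$ if $A\cap X\le X$ for all finite $X\subseteq M$. Let $f:[0,\infty)\to\mathbb R$ be continuous and increasing with $f(x)\to\infty$ as $x\to\infty$, and suppose that $f$ has at each $x\ge 0$ a right derivative $f'(x)$, that $f'$ is non-increasing, and that $$f'(x)\le \frac{1}{2(x+1)}\qquad\text{for all } x\ge 0 .$$ Let $\mathcal K_f$ be the class of finite $L$-structures $A$ such that $\delta(X)>0$ for every non-empty $X\subseteq A$ and $\delta(X)\ge f(|X|)$ for every $X\subseteq A$. Let $M_f$ be the generic structure of $(\mathcal K_f,\le)$, that is, the countable $L$-structure such that 1. $M_f$ is the union of a chain of finite substructures $C\le M_f$ with $C\in\mathcal K_f$; 2. if $A\le M_f$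 is finite and $A\le B\in\mathcal K_f$, then there is an embedding $\beta:B\to M_f$ with $\beta(B)\le M_f$ and $\beta(a)=a$ for all $a\in A$. For finite $X,Y\subseteq M_f$ let $d(X)=\min\{\delta(Z): X\subseteq Z\subseteq M_f,\ Z\text{ finite}\}$ and $d(X/Y)=d(X\cup Y)-d(Y)$; tuples are identified here with the sets of their entries. Let $\mathrm{Def}(M_f)$ be the collection of all non-empty subsets of $M_f^n$, $n\ge1$, that are definable with parameters, and suppose that $h=(\dim,\mu):\mathrm{Def}(M_f)\to\mathbb N\times\mathbb R^{>0}$ is a dimension-measure function, that is: 1. if $X$ is finite then $h(X)=(0,|X|)$; 2. for every $L$-formula $\phi(\bar x,\bar y)$, the function $\bar a\mapsto h(\phi(M_f,\bar a))$ (for those $\bar a$ with $\phi(M_f,\bar a)\neq\emptyset$) takes only finitely many values, and for each value the set of $\bar a$ giving this value is $0$-definable; 3. if $g:X\to Y$ is a definable surjection with $X,Y\in \mathrm{Def}(M_f)$, and $Y$ is the disjoint union of $Y_1,\dots,Y_r\in\mathrm{Def}(M_f)$ such that $h(g^{-1}(y))=(d_i,m_i)$ for all $y\in Y_i$, and $h(Y_i)=(e_i,n_i)$,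 then $h(X)=\bigl(c,\sum_{i:\,d_i+e_i=c}m_in_i\bigr)$, where $c=\max_i(d_i+e_i)$. For finite tuples $\bar a,\bar b$ in $M_f$ (with $\bar b$ non-empty) let $\dim(\bar b/\bar a)$ be the dimension of the (definable) set of realizations in $M_f$ of the type of $\bar b$ over $\bar a$. Then for all such $\bar a,\bar b$ $$\dim(\bar b/\bar a)=\dim(M_f)\cdot d(\bar b/\bar a).$$ In other words, any dimension on $M_f$ that comes from a dimension-measure function is a rescaling of $d$. -/

import Mathlib

namespace MSHrushovski

open FirstOrder Set

universe u v w

section Predimension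

variable (L : FirstOrder.Language.{u, v}) [Fintype (Σ n, L.Relations n)] {M : Type w} [L.Structure M]

/-- The predimension `δ(X) = |X| - ∑ᵢ |Rᵢ[X]|` of (the substructure with domain) a finite subset
`X` of a structure, where `Rᵢ[X]` is the set of tuples of elements of `X` that satisfy `Rᵢ`.
It is only used for finite `X`. -/
noncomputable def predim (X : Set M) : ℤ :=
  (X.ncard : ℤ) -
    ∑ i : Σ n, L.Relations n,
      (({t : Fin i.1 → M | (∀ k, t k ∈ X) ∧ FirstOrder.Language.Structure.RelMap i.2 t}).ncard : ℤ)

/-- `A ≤ B` for finite subsets `A ⊆ B` of a structure: `δ(A) < δ(B')` for all `A ⊂ B' ⊆ B`. -/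
def SelfSufficient (A B : Set M) : Prop :=
  A ⊆ B ∧ ∀ B' : Set M, A ⊂ B' → B' ⊆ B → predim L A < predim L B'

/-- `A ≤ M` for a subset `A` of a possibly infinite structure `M`: `A ∩ X ≤ X` for all finite
subsets `X` of `M`. -/
def SelfSufficientIn (A : Set M) : Prop :=
  ∀ X : Set M, X.Finite → SelfSufficient L (A ∩ X) X

/-- The finite substructure with domain `A` belongs to the class `𝒦_f`: every non-empty `X ⊆ A`
has `δ(X) > 0` and every `X ⊆ A` has `δ(X) ≥ f(|X|)`. It is only used for finite `A`. -/
def InClass (f : ℝ → ℝ) (A : Set M) : Prop :=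
  ∀ X : Set M, X ⊆ A → (X.Nonempty → 0 < predim L X) ∧ f (X.ncard : ℝ) ≤ (predim L X : ℝ)

/-- The dimension `d(X) = min {δ(Y) : X ⊆ Y ⊆ M, Y finite}` of a finite subset `X` of `M`. The
infimum is a minimum when the finite non-empty subsets of `M` have positive predimension. -/
noncomputable def dimD (X : Set M) : ℤ :=
  sInf {z : ℤ | ∃ Y : Set M, Y.Finite ∧ X ⊆ Y ∧ predim L Y = z}

/-- The relative dimension `d(X/Y) = d(X ∪ Y) - d(Y)`. -/
noncomputable def relDimD (X Y : Set M) : ℤ :=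
  dimD L (X ∪ Y) - dimD L Y

/-- `M` is the generic structure `M_f` of the class `(𝒦_f, ≤)`: it is the union of a chain of finite
self-sufficient substructures which are in `𝒦_f`, and it has the `≤`-extension property. Here the
finite self-sufficient substructure `A` of `M` and the inclusion of `A` in `B` are given by the
embeddings `j` and `i`. -/
structure IsGeneric (f : ℝ → ℝ) (M : Type w) [L.Structure M] : Prop where
  exists_chain : ∃ C : ℕ → Set M, Monotone C ∧ (⋃ k, C k) = univ ∧
    ∀ k, (C k).Finite ∧ SelfSufficientIn L (C k) ∧ InClass L f (C k)
  extension : ∀ (A B : Type) [L.Structure A] [L.Structure B] [Finite A] [Finite B],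
    InClass L f (univ : Set B) →
    ∀ (j : A ↪[L] M) (i : A ↪[L] B),
      SelfSufficientIn L (range j) → SelfSufficient L (range i) univ →
      ∃ β : B ↪[L] M, SelfSufficientIn L (range β) ∧ ∀ x, β (i x) = j x

end Predimension

/-- The functions that control the growth of the predimension: continuous increasing functions
on `[0, ∞)` with limit `∞`, having at each point a right derivative, which is
non-increasing and at most `1 / (x + 1)`. Values of `f` at negative reals are irrelevant. -/
structure GoodFunction (f : ℝ → ℝ) : Prop where
  continuousOn : ContinuousOn f (Ici 0)
  monotoneOn : MonotoneOn f (Ici 0)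
  tendsto_atTop : Filter.Tendsto f Filter.atTop Filter.atTop
  differentiable_right : ∀ x, 0 ≤ x → DifferentiableWithinAt ℝ f (Ioi x) x
  antitoneOn_deriv : AntitoneOn (fun x => derivWithin f (Ioi x) x) (Ici 0)
  deriv_le : ∀ x, 0 ≤ x → derivWithin f (Ioi x) x ≤ 1 / (x + 1)

section Measurable

variable (L : FirstOrder.Language.{u, v}) (M : Type w) [L.Structure M]

/-- A dimension-measure function `h = (dim, μ)` on the structure `M`. The values of `dim` and `mu`
matter only on `Def(M)`, the non-empty subsets of `M ^ n` (`n ≥ 1`) which are definable with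
parameters; on other sets they are arbitrary. -/
structure DimensionMeasure where
  /-- the dimension -/
  dim : ∀ {n : ℕ}, Set (Fin n → M) → ℕ
  /-- the measure -/
  mu : ∀ {n : ℕ}, Set (Fin n → M) → ℝ
  mu_pos : ∀ {n : ℕ}, 0 < n → ∀ X : Set (Fin n → M),
    (univ : Set M).Definable L X → X.Nonempty → 0 < mu X
  finite_sets : ∀ {n : ℕ}, 0 < n → ∀ X : Set (Fin n → M), X.Finite → X.Nonempty →
    dim X = 0 ∧ mu X = X.ncard
  /-- in a family `φ(x, a)` only finitely many values occur -/
  finite_values : ∀ {n m : ℕ}, 0 < n → ∀ φ : L.Formula (Fin n ⊕ Fin m),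
    {p : ℕ × ℝ | ∃ a : Fin m → M, {x : Fin n → M | φ.Realize (Sum.elim x a)}.Nonempty ∧
      p = (dim {x : Fin n → M | φ.Realize (Sum.elim x a)},
        mu {x : Fin n → M | φ.Realize (Sum.elim x a)})}.Finite
  /-- the set of parameters giving a fixed value is `0`-definable -/
  definable_values : ∀ {n m : ℕ}, 0 < n → ∀ (φ : L.Formula (Fin n ⊕ Fin m)) (d : ℕ) (c : ℝ),
    (∅ : Set M).Definable L {a : Fin m → M |
      {x : Fin n → M | φ.Realize (Sum.elim x a)}.Nonempty ∧
      dim {x : Fin n → M | φ.Realize (Sum.elim x a)} = d ∧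
      mu {x : Fin n → M | φ.Realize (Sum.elim x a)} = c}
  /-- Let `g : X → Y` be a definable surjection, and let `Y` be partitioned into definable sets
  `Z i` such that the fibres over points of `Z i` have dimension `d i` and measure `c i`. Then
  `dim X` is the maximum of the `d i + dim (Z i)`, and `μ(X)` is the sum of the `c i * μ(Z i)` over
  the `i` where this maximum is attained. -/
  fubini : ∀ {n m : ℕ}, 0 < n → 0 < m →
    ∀ (X : Set (Fin n → M)) (Y : Set (Fin m → M)) (g : (Fin n → M) → (Fin m → M)),
    (univ : Set M).Definable L X → X.Nonempty → (univ : Set M).Definable L Y → g '' X = Y →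
    (univ : Set M).Definable L
      {z : Fin n ⊕ Fin m → M | z ∘ Sum.inl ∈ X ∧ g (z ∘ Sum.inl) = z ∘ Sum.inr} →
    ∀ (r : ℕ) (Z : Fin r → Set (Fin m → M)) (d : Fin r → ℕ) (c : Fin r → ℝ),
    (∀ i, (univ : Set M).Definable L (Z i)) → (∀ i, (Z i).Nonempty) →
    Pairwise (fun i j => Disjoint (Z i) (Z j)) → (⋃ i, Z i) = Y →
    (∀ i, ∀ y ∈ Z i, dim {x ∈ X | g x = y} = d i ∧ mu {x ∈ X | g x = y} = c i) →
    dim X = Finset.univ.sup (fun i => d i + dim (Z i)) ∧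
    mu X = ∑ i with d i + dim (Z i) = dim X, c i * mu (Z i)

variable {M}

/-- The locus of `b` over `a`: the set of realizations in `M` of the type of `b` over `a`. -/
def locus {m n : ℕ} (a : Fin m → M) (b : Fin n → M) : Set (Fin n → M) :=
  {x | ∀ φ : L.Formula (Fin m ⊕ Fin n), φ.Realize (Sum.elim a x) ↔ φ.Realize (Sum.elim a b)}

end Measurable

end MSHrushovski

/-! Both `dim` and `d` are additive when a tuple is split: `dim` by the fibre axiom
(`dim_locus_add`), `d` by definition. So it suffices to treat one point over a finite set, where the
relative `d` is 0 or 1. If it is 0, every realization lies in a finite closure of the parameters, so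
the locus is finite and `dim` is 0. What remains is that every one-point type of rank one has the
full dimension of `M` (`dim_locus_eq_dim_univ`).

Take a rank-one type of `b` over `a` with least dimension `k`; `a` may be assumed closed. Let `z`
have locus over `a` of dimension `dim M`; if `z` has rank 0 over `a`, then `dim M = 0`. Otherwise a
ternary relation links realizations `y 0`, `y 1` of the type of `b` and `y 2` of the type of `z` so
that any two are independent over `a` while all three have rank 2 (`exists_linked`). Each is then
algebraic over the other two, and the dimension of the triple can be computed from `y 0, y 1` or
from `y 2, y 1`. Given `y 0` or `y 2`, the point `y 1` still has rank one, so its dimension is at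
least `k` by minimality and at most its dimension over `a`, which is `k`. Hence `k + k = dim M + k`.

The link comes from gluing three closures freely over `a` and adding one related triple: each
component raises the predimension by one and the triple lowers it by one. The bound `1 / (2 * (x +
1))` on the derivative keeps this amalgam in the class (`GoodFunction.growth`).

Types are under control because closed tuples with equal diagrams have equal types (back and forth),
and closures have bounded size. Hence there are finitely many types in each arity, all isolated, so
loci are definable. -/

namespace MSHrushovski

open FirstOrder Set
open FirstOrder.Language.Structure (RelMap)

universe u v w w'

/-! ### Predimension, submodularity and self-sufficiency -/

section Predim

variable (L : FirstOrder.Language.{u, v}) {M : Type w} [L.Structure M] {N : Type w'}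
  [L.Structure N]

/-- The tuples of elements of `X` which satisfy some relation, tagged by the relation. -/
def relTuples (X : Set M) : Set (Σ i : (Σ n, L.Relations n), Fin i.1 → M) :=
  {p | (∀ k, p.2 k ∈ X) ∧ RelMap p.1.2 p.2}

lemma relTuples_mono {X Y : Set M} (h : X ⊆ Y) : relTuples L X ⊆ relTuples L Y :=
  fun _ hp => ⟨fun k => h (hp.1 k), hp.2⟩

lemma relTuples_inter (X Y : Set M) :
    relTuples L (X ∩ Y) = relTuples L X ∩ relTuples L Y := by
  ext p
  constructor
  · exact fun hp => ⟨⟨fun k => (hp.1 k).1, hp.2⟩, ⟨fun k => (hp.1 k).2, hp.2⟩⟩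
  · exact fun hp => ⟨fun k => ⟨hp.1.1 k, hp.2.1 k⟩, hp.1.2⟩

variable [Fintype (Σ n, L.Relations n)]

/-- The tuples of a finite set that satisfy a given relation form a finite set. -/
lemma finite_tuples {n : ℕ} {X : Set M} (hX : X.Finite) (P : (Fin n → M) → Prop) :
    {t : Fin n → M | (∀ k, t k ∈ X) ∧ P t}.Finite := by
  refine (Set.Finite.pi' (fun _ : Fin n => hX)).subset fun t ht => ?_
  exact ht.1

lemma relTuples_finite {X : Set M} (hX : X.Finite) : (relTuples L X).Finite := by
  have : relTuples L X = ⋃ i : (Σ n, L.Relations n),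
      Sigma.mk i '' {t : Fin i.1 → M | (∀ k, t k ∈ X) ∧ RelMap i.2 t} := by
    ext ⟨i, t⟩
    simp only [relTuples, mem_ofPred_eq, mem_iUnion, mem_image]
    constructor
    · exact fun h => ⟨i, t, h, rfl⟩
    · rintro ⟨j, s, hs, h⟩
      cases h
      exact hs
  rw [this]
  exact Set.finite_iUnion fun i => (finite_tuples hX _).image _

/-- Collecting all relations into one set of tagged tuples turns the later estimates into counting
in two sets. -/
lemma predim_eq {X : Set M} (hX : X.Finite) :
    predim L X = (X.ncard : ℤ) - ((relTuples L X).ncard : ℤ) := by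
  rw [predim, ← Nat.cast_sum]
  congr 2
  have e : relTuples L X ≃ Σ i : (Σ n, L.Relations n),
      {t : Fin i.1 → M | (∀ k, t k ∈ X) ∧ RelMap i.2 t} :=
    { toFun := fun p => ⟨p.1.1, p.1.2, p.2⟩
      invFun := fun q => ⟨⟨q.1, q.2.1⟩, q.2.2⟩
      left_inv := fun _ => rfl
      right_inv := fun _ => rfl }
  have hfin : ∀ i : (Σ n, L.Relations n),
      Finite {t : Fin i.1 → M | (∀ k, t k ∈ X) ∧ RelMap i.2 t} :=
    fun i => (finite_tuples hX _).to_subtype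
  rw [← Nat.card_coe_set_eq, Nat.card_congr e, Nat.card_sigma]
  rfl

/-- Cardinality is modular, and a tuple lies in `X ∩ Y` exactly when it lies in both sets, but `X ∪
Y` may carry tuples that lie in neither. -/
lemma predim_submodular {X Y : Set M} (hX : X.Finite) (hY : Y.Finite) :
    predim L (X ∪ Y) + predim L (X ∩ Y) ≤ predim L X + predim L Y := by
  rw [predim_eq L hX, predim_eq L hY, predim_eq L (hX.union hY),
    predim_eq L (hX.inter_of_left Y), relTuples_inter]
  have h1 := ncard_union_add_ncard_inter X Y hX hY
  have h2 := ncard_union_add_ncard_inter _ _ (relTuples_finite L hX) (relTuples_finite L hY)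
  have h3 : (relTuples L X ∪ relTuples L Y).ncard ≤ (relTuples L (X ∪ Y)).ncard :=
    ncard_le_ncard (union_subset (relTuples_mono L subset_union_left)
      (relTuples_mono L subset_union_right)) (relTuples_finite L (hX.union hY))
  omega

lemma predim_le_ncard {X : Set M} (hX : X.Finite) : predim L X ≤ X.ncard := by
  rw [predim_eq L hX]
  omega

lemma predim_insert_le {X : Set M} (hX : X.Finite) (b : M) :
    predim L (insert b X) ≤ predim L X + 1 := by
  rw [predim_eq L hX, predim_eq L (hX.insert b)]
  have h1 := ncard_insert_le b X
  have h2 := ncard_le_ncard (relTuples_mono L (subset_insert b X))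
    (relTuples_finite L (hX.insert b))
  omega

lemma predim_empty [h0 : IsEmpty (L.Relations 0)] : predim L (∅ : Set M) = 0 := by
  rw [predim_eq L finite_empty]
  have : relTuples L (∅ : Set M) = ∅ := by
    ext ⟨⟨n, R⟩, t⟩
    simp only [relTuples, mem_ofPred_eq, mem_empty_iff_false, iff_false, not_and]
    intro h
    cases n with
    | zero => exact h0.elim R
    | succ n => exact (h 0).elim
  simp [this]

/-- The restriction of `g` to `X` is an embedding of structures. -/
def EmbedsOn (g : M → N) (X : Set M) : Prop :=
  InjOn g X ∧ ∀ ⦃n : ℕ⦄ (R : L.Relations n) (t : Fin n → M), (∀ k, t k ∈ X) →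
    (RelMap R (g ∘ t) ↔ RelMap R t)

variable {L}

omit [Fintype (Σ n, L.Relations n)] in
lemma EmbedsOn.mono {g : M → N} {X Y : Set M} (h : EmbedsOn L g Y) (hXY : X ⊆ Y) :
    EmbedsOn L g X :=
  ⟨h.1.mono hXY, fun _ R t ht => h.2 R t fun k => hXY (ht k)⟩

lemma EmbedsOn.predim_image {g : M → N} {X : Set M} (h : EmbedsOn L g X) :
    predim L (g '' X) = predim L X := by
  rw [predim, predim, h.1.ncard_image]
  congr 1
  refine Finset.sum_congr rfl fun i _ => ?_
  have : {t : Fin i.1 → N | (∀ k, t k ∈ g '' X) ∧ RelMap i.2 t} =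
      (fun t : Fin i.1 → M => g ∘ t) '' {t | (∀ k, t k ∈ X) ∧ RelMap i.2 t} := by
    ext t
    constructor
    · rintro ⟨h1, h2⟩
      choose s hs hst using h1
      have : g ∘ s = t := funext hst
      subst this
      exact ⟨s, ⟨hs, (h.2 _ _ hs).1 h2⟩, rfl⟩
    · rintro ⟨s, ⟨hs, hr⟩, rfl⟩
      exact ⟨fun k => mem_image_of_mem _ (hs k), (h.2 _ _ hs).2 hr⟩
  rw [this, InjOn.ncard_image]
  intro s hs t ht hst
  funext k
  exact h.1 (hs.1 k) (ht.1 k) (congrFun hst k)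

omit [Fintype (Σ n, L.Relations n)] in
lemma embedsOn_embedding (g : M ↪[L] N) (X : Set M) : EmbedsOn L g X :=
  ⟨g.injective.injOn, fun _ R t _ => g.map_rel R t⟩

lemma EmbedsOn.inClass {f : ℝ → ℝ} {g : M → N} {X : Set M} (h : EmbedsOn L g X)
    (hX : InClass L f X) : InClass L f (g '' X) := by
  intro Y hY
  obtain ⟨Z, hZ, rfl⟩ := subset_image_iff.1 hY
  rw [(h.mono hZ).predim_image, (h.1.mono hZ).ncard_image, image_nonempty]
  exact hX Z hZ

lemma EmbedsOn.selfSufficient {g : M → N} {X Y : Set M} (h : EmbedsOn L g Y)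
    (hX : SelfSufficient L X Y) : SelfSufficient L (g '' X) (g '' Y) := by
  refine ⟨image_mono hX.1, fun B hB hBY => ?_⟩
  obtain ⟨Z, hZ, rfl⟩ := subset_image_iff.1 hBY
  rw [(h.mono hZ).predim_image, (h.mono hX.1).predim_image]
  refine hX.2 Z ⟨?_, ?_⟩ hZ
  · exact (h.1.image_subset_image_iff hX.1 hZ).1 hB.1
  · exact fun hZX => hB.2 (image_mono hZX)

lemma EmbedsOn.inClass_of_image {f : ℝ → ℝ} {g : M → N} {X : Set M} (h : EmbedsOn L g X)
    (hX : InClass L f (g '' X)) : InClass L f X := by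
  intro Z hZ
  have := hX (g '' Z) (image_mono hZ)
  rwa [(h.mono hZ).predim_image, (h.1.mono hZ).ncard_image, image_nonempty] at this

lemma EmbedsOn.selfSufficient_of_image {g : M → N} {X Y : Set M} (h : EmbedsOn L g Y)
    (hXY : X ⊆ Y) (hX : SelfSufficient L (g '' X) (g '' Y)) : SelfSufficient L X Y := by
  refine ⟨hXY, fun B hB hBY => ?_⟩
  have := hX.2 (g '' B) ⟨image_mono hB.1, fun h' => hB.2 ?_⟩ (image_mono hBY)
  · rwa [(h.mono hBY).predim_image, (h.mono hXY).predim_image] at this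
  · exact (h.1.image_subset_image_iff hBY hXY).1 h'

lemma InClass.mono {f : ℝ → ℝ} {X Y : Set M} (h : InClass L f Y) (hXY : X ⊆ Y) :
    InClass L f X := fun Z hZ => h Z (hZ.trans hXY)

/-- By submodularity, passing from `B ∩ Y` to `B` costs at least as much as passing from `Y` to `B ∪
Y`, which is positive. -/
lemma SelfSufficient.trans {X Y Z : Set M} (hZ : Z.Finite) (h1 : SelfSufficient L X Y)
    (h2 : SelfSufficient L Y Z) : SelfSufficient L X Z := by
  refine ⟨h1.1.trans h2.1, fun B hB hBZ => ?_⟩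
  have hBf := hZ.subset hBZ
  by_cases hBY : B ⊆ Y
  · exact h1.2 B hB hBY
  have hYf := hZ.subset h2.1
  have hsub := predim_submodular L hBf hYf
  have h3 : predim L Y < predim L (B ∪ Y) :=
    h2.2 _ (ssubset_iff_subset_not_subset.2 ⟨subset_union_right,
      fun h => hBY (subset_union_left.trans h)⟩) (union_subset hBZ h2.1)
  have h4 : predim L X ≤ predim L (B ∩ Y) := by
    by_cases h : B ∩ Y ⊆ X
    · rw [h.antisymm (subset_inter hB.1 h1.1)]
    · exact (h1.2 _ ⟨subset_inter hB.1 h1.1, h⟩ inter_subset_right).le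
  omega

lemma SelfSufficient.inter {X Y : Set M} (hY : Y.Finite) (h : SelfSufficient L X Y)
    {Z : Set M} (hZ : Z ⊆ Y) : SelfSufficient L (X ∩ Z) Z := by
  refine ⟨inter_subset_right, fun B hB hBZ => ?_⟩
  have hsub := predim_submodular L (hY.subset h.1) (hY.subset (hBZ.trans hZ))
  have h1 : X ∩ B = X ∩ Z := by
    refine (inter_subset_inter_right X hBZ).antisymm (subset_inter inter_subset_left hB.1)
  have h2 : predim L X < predim L (X ∪ B) := by
    refine h.2 _ ⟨subset_union_left, fun h' => hB.2 fun x hx => ?_⟩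
      (union_subset h.1 (hBZ.trans hZ))
    exact ⟨h' (Or.inr hx), hBZ hx⟩
  rw [h1] at hsub
  omega

lemma selfSufficientIn_iff {A : Set M} (hA : A.Finite) :
    SelfSufficientIn L A ↔ ∀ Y : Set M, Y.Finite → A ⊂ Y → predim L A < predim L Y := by
  constructor
  · intro h Y hY hAY
    have := (h Y hY).2 Y
    rw [inter_eq_left.2 hAY.1] at this
    exact this hAY le_rfl
  · intro h X hX
    have : SelfSufficient L A (A ∪ X) := ⟨subset_union_left, fun B hB hBX =>
      h B ((hA.union hX).subset hBX) hB⟩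
    exact this.inter (hA.union hX) subset_union_right

lemma SelfSufficientIn.predim_inter_le {A Y : Set M} (h : SelfSufficientIn L A)
    (hY : Y.Finite) : predim L (A ∩ Y) ≤ predim L Y := by
  by_cases h' : Y ⊆ A
  · rw [inter_eq_right.2 h']
  · exact ((h Y hY).2 Y ⟨inter_subset_right, fun h2 => h' fun x hx => (h2 hx).1⟩ le_rfl).le

lemma SelfSufficientIn.of_selfSufficient {A B : Set M} (hB : B.Finite)
    (h : SelfSufficient L A B) (hBM : SelfSufficientIn L B) : SelfSufficientIn L A := by
  have hA := hB.subset h.1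
  refine (selfSufficientIn_iff hA).2 fun Y hY hAY => ?_
  have hU := hB.union hY
  have := (selfSufficientIn_iff hB).1 hBM
  have hBU : SelfSufficient L B (B ∪ Y) :=
    ⟨subset_union_left, fun C hC hCU => this C (hU.subset hCU) hC⟩
  exact (h.trans hU hBU).2 Y hAY subset_union_right

end Predim

/-! ### The dimension `d` and closures of finite sets -/

section Closure

variable {L : FirstOrder.Language.{u, v}} [Fintype (Σ n, L.Relations n)]
  {M : Type w} [L.Structure M] {f : ℝ → ℝ}

lemma IsGeneric.inClass_of_finite (hM : IsGeneric L f M) {X : Set M} (hX : X.Finite) :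
    InClass L f X := by
  obtain ⟨C, hmono, hU, hC⟩ := hM.exists_chain
  have : ∃ k, X ⊆ C k := by
    induction X, hX using Set.Finite.induction_on with
    | empty => exact ⟨0, empty_subset _⟩
    | @insert x X _ _ ih =>
      obtain ⟨k, hk⟩ := ih
      obtain ⟨l, hl⟩ := mem_iUnion.1 (hU.symm ▸ mem_univ x)
      exact ⟨max k l, insert_subset (hmono (le_max_right k l) hl)
        (hk.trans (hmono (le_max_left k l)))⟩
  obtain ⟨k, hk⟩ := this
  exact (hC k).2.2.mono hk

lemma GoodFunction.exists_card_bound (hf : GoodFunction f) (N : ℕ) :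
    ∃ K : ℕ, ∀ n : ℕ, f n ≤ N → n ≤ K := by
  have h := (hf.tendsto_atTop.comp (tendsto_natCast_atTop_atTop (R := ℝ))).eventually_gt_atTop
    (N : ℝ)
  obtain ⟨K, hK⟩ := Filter.eventually_atTop.1 h
  refine ⟨K, fun n hn => ?_⟩
  by_contra! hlt
  exact absurd (hK n hlt.le) (not_lt.2 hn)

lemma predim_nonneg [IsEmpty (L.Relations 0)]
    (hC : ∀ X : Set M, X.Finite → InClass L f X) {X : Set M} (hX : X.Finite) :
    0 ≤ predim L X := by
  rcases X.eq_empty_or_nonempty with rfl | h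
  · exact (predim_empty L).ge
  · exact ((hC X hX X le_rfl).1 h).le

lemma le_dimD {X : Set M} (hX : X.Finite) {z : ℤ}
    (h : ∀ Y : Set M, Y.Finite → X ⊆ Y → z ≤ predim L Y) : z ≤ dimD L X := by
  refine le_csInf ⟨_, X, hX, le_rfl, rfl⟩ ?_
  rintro _ ⟨Y, hY, hXY, rfl⟩
  exact h Y hY hXY

variable [IsEmpty (L.Relations 0)]

lemma dimD_le (hC : ∀ X : Set M, X.Finite → InClass L f X) {X Y : Set M} (hY : Y.Finite)
    (hXY : X ⊆ Y) : dimD L X ≤ predim L Y := by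
  refine csInf_le ⟨0, ?_⟩ ⟨Y, hY, hXY, rfl⟩
  rintro _ ⟨Z, hZ, -, rfl⟩
  exact predim_nonneg hC hZ

lemma exists_predim_eq_dimD (hC : ∀ X : Set M, X.Finite → InClass L f X) {X : Set M}
    (hX : X.Finite) : ∃ Y : Set M, Y.Finite ∧ X ⊆ Y ∧ predim L Y = dimD L X := by
  refine Int.csInf_mem (s := {z : ℤ | ∃ Y : Set M, Y.Finite ∧ X ⊆ Y ∧ predim L Y = z})
    ⟨_, X, hX, le_rfl, rfl⟩ ⟨0, ?_⟩
  rintro _ ⟨Z, hZ, -, rfl⟩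
  exact predim_nonneg hC hZ

lemma dimD_mono (hC : ∀ X : Set M, X.Finite → InClass L f X) {X Y : Set M} (hY : Y.Finite)
    (hXY : X ⊆ Y) : dimD L X ≤ dimD L Y :=
  le_dimD hY fun _ hZ hYZ => dimD_le hC hZ (hXY.trans hYZ)

lemma dimD_insert_le (hC : ∀ X : Set M, X.Finite → InClass L f X) {X : Set M} (hX : X.Finite)
    (b : M) : dimD L (insert b X) ≤ dimD L X + 1 := by
  obtain ⟨Y, hY, hXY, h⟩ := exists_predim_eq_dimD hC hX
  rw [← h]
  exact (dimD_le hC (hY.insert b) (insert_subset_insert hXY)).trans (predim_insert_le L hY b)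

lemma dimD_le_ncard (hC : ∀ X : Set M, X.Finite → InClass L f X) {X : Set M} (hX : X.Finite) :
    dimD L X ≤ X.ncard :=
  (dimD_le hC hX le_rfl).trans (predim_le_ncard L hX)

lemma SelfSufficientIn.dimD_eq (hC : ∀ X : Set M, X.Finite → InClass L f X) {A : Set M}
    (hA : A.Finite) (h : SelfSufficientIn L A) : dimD L A = predim L A := by
  refine (dimD_le hC hA le_rfl).antisymm (le_dimD hA fun Y hY hAY => ?_)
  have := h.predim_inter_le hY
  rwa [inter_eq_left.2 hAY] at this

/-- The closure of a finite set: a finite self-sufficient set of the same dimension, whose size is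
bounded in terms of the size of the set. -/
lemma exists_closure (hC : ∀ X : Set M, X.Finite → InClass L f X) {K N : ℕ}
    (hK : ∀ n : ℕ, f n ≤ N → n ≤ K) {X : Set M} (hX : X.Finite) (hXN : X.ncard ≤ N) :
    ∃ C : Set M, C.Finite ∧ X ⊆ C ∧ SelfSufficientIn L C ∧ predim L C = dimD L X ∧
      C.ncard ≤ K := by
  have hb : ∀ Y : Set M, Y.Finite → X ⊆ Y → predim L Y = dimD L X → Y.ncard ≤ K := by
    intro Y hY _ h
    refine hK _ ((hC Y hY Y le_rfl).2.trans ?_)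
    rw [h]
    exact_mod_cast (dimD_le_ncard hC hX).trans (by exact_mod_cast hXN)
  obtain ⟨Y0, hY0, hXY0, h0⟩ := exists_predim_eq_dimD hC hX
  -- Among the sets of least predimension take one of largest size. Sizes are bounded since `f(|Y|)
  -- ≤ δ(Y) = d(X) ≤ N`, and maximality makes every proper extension strictly larger in
  -- predimension.
  let S : Set ℕ := {n | ∃ Y : Set M, Y.Finite ∧ X ⊆ Y ∧ predim L Y = dimD L X ∧ Y.ncard = n}
  have hSb : BddAbove S := ⟨K, by rintro _ ⟨Y, h1, h2, h3, rfl⟩; exact hb Y h1 h2 h3⟩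
  obtain ⟨C, hCf, hXC, hd, hCS⟩ : sSup S ∈ S := Nat.sSup_mem ⟨_, Y0, hY0, hXY0, h0, rfl⟩ hSb
  refine ⟨C, hCf, hXC, (selfSufficientIn_iff hCf).2 fun Y hY hCY => ?_, hd, hb C hCf hXC hd⟩
  have h1 := dimD_le hC hY (hXC.trans hCY.1)
  refine lt_of_le_of_ne (hd ▸ h1) fun h2 => ?_
  have h3 : Y.ncard ≤ C.ncard := hCS ▸ le_csSup hSb ⟨Y, hY, hXC.trans hCY.1, h2 ▸ hd, rfl⟩
  exact absurd (ncard_lt_ncard hCY hY) (not_lt.2 h3)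

/-- Let `Y` realize `d(X ∪ {c})`. If `c` were outside `C`, then `δ(C ∩ Y) < δ(Y) = d(X)` although `C
∩ Y` contains `X`. This is the source of all algebraicity below. -/
lemma mem_closure_of_dimD_eq (hC : ∀ X : Set M, X.Finite → InClass L f X) {X C : Set M}
    (hCf : C.Finite) (hXC : X ⊆ C) (hcl : SelfSufficientIn L C) {c : M}
    (h : dimD L (insert c X) = dimD L X) (hX : X.Finite) : c ∈ C := by
  obtain ⟨Y, hY, hXY, hd⟩ := exists_predim_eq_dimD hC (hX.insert c)
  by_contra hc
  have h1 := (hcl Y hY).2 Y ⟨inter_subset_right, fun h => hc (h (hXY (mem_insert c X))).1⟩ le_rfl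
  have h2 := dimD_le hC (hCf.inter_of_left Y) (subset_inter hXC ((subset_insert c X).trans hXY))
  omega

end Closure

/-! ### Back and forth between closed tuples -/

section Homogeneity

variable {L : FirstOrder.Language.{u, v}} {M : Type w} [L.Structure M]

/-- The structure which a map into a structure for a relational language induces on its domain. -/
abbrev comapStructure (hrel : L.IsRelational) {B : Type w'} (g : B → M) : L.Structure B where
  funMap f _ := (hrel _).elim f
  RelMap R t := RelMap R (g ∘ t)

/-- Two tuples have the same quantifier-free diagram. -/
def SameDiagram (L : FirstOrder.Language.{u, v}) {M : Type w} [L.Structure M] {ι : Type*}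
    (s t : ι → M) : Prop :=
  (∀ i j, s i = s j ↔ t i = t j) ∧
    ∀ ⦃n : ℕ⦄ (R : L.Relations n) (u : Fin n → ι), RelMap R (s ∘ u) ↔ RelMap R (t ∘ u)

lemma SameDiagram.symm {ι : Type*} {s t : ι → M} (h : SameDiagram L s t) : SameDiagram L t s :=
  ⟨fun i j => (h.1 i j).symm, fun _ R u => (h.2 R u).symm⟩

variable [Fintype (Σ n, L.Relations n)] {f : ℝ → ℝ}

/-- The extension property, for extensions in an arbitrary universe. -/
lemma IsGeneric.exists_extension (hrel : L.IsRelational) (hM : IsGeneric L f M) {B : Type w'}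
    [L.Structure B] [Finite B] (hB : InClass L f (univ : Set B)) {A : Set B}
    (hA : SelfSufficient L A univ) {j : B → M} (hj : EmbedsOn L j A)
    (hjA : SelfSufficientIn L (j '' A)) :
    ∃ β : B ↪[L] M, SelfSufficientIn L (range β) ∧ ∀ x ∈ A, β x = j x := by
  -- The extension axiom speaks of structures in `Type`, so everything is transported to `Fin k`.
  obtain ⟨k, ⟨e⟩⟩ := Finite.exists_equiv_fin B
  let _ : L.Structure (Fin k) := e.inducedStructure
  let E : B ≃[L] Fin k := e.inducedStructureEquiv
  have hE : ∀ x, E x = e x := fun _ => rfl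
  let A' : Type := {x : Fin k // e.symm x ∈ A}
  let _ : L.Structure A' := comapStructure hrel Subtype.val
  let i : A' ↪[L] Fin k :=
    { toFun := Subtype.val
      inj' := Subtype.val_injective
      map_fun' := fun g => (hrel _).elim g
      map_rel' := fun _ _ => Iff.rfl }
  have hsymm : ∀ {n : ℕ} (R : L.Relations n) (t : Fin n → Fin k),
      RelMap R (e.symm ∘ t) ↔ RelMap R t := fun R t => E.symm.map_rel R t
  let j' : A' ↪[L] M :=
    { toFun := fun x => j (e.symm x.1)
      inj' := fun x y hxy => Subtype.ext (e.symm.injective (hj.1 x.2 y.2 hxy))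
      map_fun' := fun g => (hrel _).elim g
      map_rel' := fun R t => by
        refine (hj.2 R (fun m => e.symm (t m).1) fun m => (t m).2).trans ?_
        exact hsymm R (fun m => (t m).1) }
  have hr : range j' = j '' A := by
    ext y
    constructor
    · rintro ⟨x, rfl⟩
      exact ⟨_, x.2, rfl⟩
    · rintro ⟨x, hx, rfl⟩
      refine ⟨⟨e x, by simpa using hx⟩, ?_⟩
      change j (e.symm (e x)) = j x
      simp
  have hEe : EmbedsOn L E (univ : Set B) := embedsOn_embedding E.toEmbedding univ
  have huniv : E '' univ = univ := by
    rw [image_univ]; exact E.surjective.range_eq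
  have hri : range i = E '' A := by
    ext y
    constructor
    · rintro ⟨x, rfl⟩
      exact ⟨_, x.2, e.apply_symm_apply _⟩
    · rintro ⟨x, hx, rfl⟩
      exact ⟨⟨e x, by simpa using hx⟩, rfl⟩
  obtain ⟨β, hβ, hβj⟩ := hM.extension A' (Fin k) (huniv ▸ hEe.inClass hB) j' i (hr ▸ hjA)
    (by rw [hri, ← huniv]; exact hEe.selfSufficient hA)
  refine ⟨β.comp E.toEmbedding, ?_, fun x hx => ?_⟩
  · convert hβ using 1
    ext y
    constructor
    · rintro ⟨x, rfl⟩
      exact ⟨_, rfl⟩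
    · rintro ⟨x, rfl⟩
      exact ⟨e.symm x, congrArg β (e.apply_symm_apply x)⟩
  · have := hβj ⟨e x, by simpa using hx⟩
    refine this.trans ?_
    change j (e.symm (e x)) = j x
    simp

variable [IsEmpty (L.Relations 0)]

lemma IsGeneric.exists_closure (hf : GoodFunction f) (hM : IsGeneric L f M) {X : Set M} (hX : X.Finite) :
    ∃ C : Set M, C.Finite ∧ X ⊆ C ∧ SelfSufficientIn L C ∧ predim L C = dimD L X := by
  obtain ⟨K, hK⟩ := hf.exists_card_bound X.ncard
  obtain ⟨C, h1, h2, h3, h4, -⟩ :=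
    MSHrushovski.exists_closure (fun _ hX => hM.inClass_of_finite hX) hK hX le_rfl
  exact ⟨C, h1, h2, h3, h4⟩

/-- The back-and-forth step: close `s` together with `c`, and re-embed this closure over `t` by the
extension property. The new tuples enumerate the closure and its copy. -/
lemma IsGeneric.exists_extend_sameDiagram (hrel : L.IsRelational) (hf : GoodFunction f)
    (hM : IsGeneric L f M) {k : ℕ} {s t : Fin k → M} (hst : SameDiagram L s t)
    (hs : SelfSufficientIn L (range s)) (ht : SelfSufficientIn L (range t)) (c : M) :
    ∃ (l : ℕ) (s' t' : Fin l → M) (e : Fin k → Fin l) (z : Fin l), SameDiagram L s' t' ∧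
      SelfSufficientIn L (range s') ∧ SelfSufficientIn L (range t') ∧ s = s' ∘ e ∧ t = t' ∘ e ∧
      s' z = c := by
  classical
  obtain ⟨C, hCf, hXC, hcl, -⟩ := hM.exists_closure hf ((finite_range s).insert c)
  have : Finite C := hCf.to_subtype
  let _ : L.Structure C := comapStructure hrel Subtype.val
  have hval : ∀ X : Set C, EmbedsOn L (Subtype.val : C → M) X :=
    fun X => ⟨Subtype.val_injective.injOn, fun _ _ _ _ => Iff.rfl⟩
  have hsC : ∀ i, s i ∈ C := fun i => hXC (mem_insert_of_mem _ (mem_range_self i))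
  let A : Set C := range fun i => (⟨s i, hsC i⟩ : C)
  -- Only the values on the range of `s` matter; elsewhere the map is arbitrary.
  let j : C → M := fun x => if h : ∃ i, s i = x then t h.choose else x
  have hj : ∀ i, j ⟨s i, hsC i⟩ = t i := by
    intro i
    have h : ∃ i', s i' = s i := ⟨i, rfl⟩
    simp only [j, dif_pos h]
    exact (hst.1 _ _).1 h.choose_spec
  have hjA : EmbedsOn L j A := by
    constructor
    · rintro _ ⟨i, rfl⟩ _ ⟨i', rfl⟩ h
      simp only [hj] at h
      exact Subtype.ext ((hst.1 _ _).2 h)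
    · intro n R u hu
      choose v hv using hu
      obtain rfl : (fun m => (⟨s (v m), hsC _⟩ : C)) = u := funext hv
      have : (j ∘ fun m => (⟨s (v m), hsC _⟩ : C)) = t ∘ v := funext fun m => hj _
      rw [this]
      exact (hst.2 R v).symm
  have hjr : j '' A = range t := by
    rw [← range_comp]
    exact congrArg range (funext hj)
  have hvA : Subtype.val '' A = range s := by
    rw [← range_comp]
    rfl
  have hAu : SelfSufficient L A univ := by
    refine (hval univ).selfSufficient_of_image (subset_univ _) ?_
    rw [hvA, image_univ, Subtype.range_coe]
    have := hs C hCf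
    rwa [inter_eq_left.2 ((subset_insert _ _).trans hXC)] at this
  have hB : InClass L f (univ : Set C) := (hval univ).inClass_of_image
    (hM.inClass_of_finite (toFinite _))
  obtain ⟨β, hβ, hβj⟩ := hM.exists_extension hrel hB hAu hjA (hjr ▸ ht)
  obtain ⟨l, ⟨e⟩⟩ := Finite.exists_equiv_fin C
  refine ⟨l, fun i => (e.symm i : C), fun i => β (e.symm i), fun i => e ⟨s i, hsC i⟩,
    e ⟨c, hXC (mem_insert _ _)⟩, ⟨fun i i' => ?_, fun n R u => ?_⟩, ?_, ?_, ?_, ?_, ?_⟩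
  · rw [β.injective.eq_iff, Subtype.ext_iff]
  · exact (β.map_rel R (fun m => e.symm (u m))).symm
  · convert hcl
    ext y
    constructor
    · rintro ⟨x, rfl⟩
      exact (e.symm x).2
    · exact fun hy => ⟨e ⟨y, hy⟩, by simp⟩
  · convert hβ using 1
    exact (e.symm.surjective.range_comp β)
  · funext i
    simp
  · funext i
    simp only [Function.comp, Equiv.symm_apply_apply]
    rw [hβj _ ⟨i, rfl⟩]
    exact (hj i).symm
  · simp

lemma IsGeneric.realize_iff (hrel : L.IsRelational) (hf : GoodFunction f)
    (hM : IsGeneric L f M) {α : Type*} {n : ℕ} (φ : L.BoundedFormula α n) :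
    ∀ {k : ℕ} {s t : Fin k → M}, SameDiagram L s t → SelfSufficientIn L (range s) →
      SelfSufficientIn L (range t) → ∀ (v : α → Fin k) (x : Fin n → Fin k),
      φ.Realize (s ∘ v) (s ∘ x) ↔ φ.Realize (t ∘ v) (t ∘ x) := by
  have hterm : ∀ {n : ℕ} (τ : L.Term (α ⊕ Fin n)), ∃ i, τ = Language.Term.var i := by
    intro n τ
    cases τ with
    | var i => exact ⟨i, rfl⟩
    | func g _ => exact (hrel _).elim g
  induction φ with
  | falsum => intros; exact Iff.rfl
  | equal τ₁ τ₂ =>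
    intro k s t hst _ _ v x
    obtain ⟨i, rfl⟩ := hterm τ₁
    obtain ⟨j, rfl⟩ := hterm τ₂
    simp only [Language.BoundedFormula.Realize, Language.Term.realize_var, ← Sum.comp_elim]
    exact hst.1 _ _
  | rel R τ =>
    intro k s t hst _ _ v x
    choose i hi using fun m => hterm (τ m)
    obtain rfl : τ = fun m => Language.Term.var (i m) := funext hi
    simp only [Language.BoundedFormula.Realize, Language.Term.realize_var, ← Sum.comp_elim]
    exact hst.2 R fun m => Sum.elim v x (i m)
  | imp _ _ ih₁ ih₂ =>
    intro k s t hst hs ht v x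
    simp only [Language.BoundedFormula.realize_imp, ih₁ hst hs ht v x, ih₂ hst hs ht v x]
  | all φ ih =>
    have key : ∀ {k : ℕ} {s t : Fin k → M}, SameDiagram L s t → SelfSufficientIn L (range s) →
      SelfSufficientIn L (range t) → ∀ (v : α → Fin k) (x : Fin _ → Fin k),
      φ.all.Realize (s ∘ v) (s ∘ x) → φ.all.Realize (t ∘ v) (t ∘ x) := by
      intro k s t hst hs ht v x h a
      -- The point to be matched lies on the `t` side, so the extension step is applied with the
      -- roles exchanged.
      obtain ⟨l, t', s', e, z, hts, ht', hs', rfl, rfl, rfl⟩ :=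
        hM.exists_extend_sameDiagram hrel hf hst.symm ht hs a
      have h1 := (ih hts.symm hs' ht' (e ∘ v) (Fin.snoc (e ∘ x) z)).1
      rw [Fin.comp_snoc, Fin.comp_snoc] at h1
      exact h1 (h (s' z))
    intro k s t hst hs ht v x
    exact ⟨key hst hs ht v x, key hst.symm ht hs v x⟩

end Homogeneity

/-! ### Types: isolation, homogeneity and finiteness -/

section Types

variable {L : FirstOrder.Language.{u, v}} {M : Type w} [L.Structure M]

/-- Two tuples have the same type over the empty set. -/
def SameType (L : FirstOrder.Language.{u, v}) {M : Type w} [L.Structure M] {κ : Type*}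
    (s t : κ → M) : Prop :=
  ∀ φ : L.Formula κ, φ.Realize s ↔ φ.Realize t

lemma SameType.refl {κ : Type*} (s : κ → M) : SameType L s s := fun _ => Iff.rfl

lemma SameType.symm {κ : Type*} {s t : κ → M} (h : SameType L s t) : SameType L t s :=
  fun φ => (h φ).symm

lemma SameType.trans {κ : Type*} {s t r : κ → M} (h : SameType L s t) (h' : SameType L t r) :
    SameType L s r :=
  fun φ => (h φ).trans (h' φ)

lemma SameType.comp {κ ι : Type*} {s t : κ → M} (h : SameType L s t) (u : ι → κ) :
    SameType L (s ∘ u) (t ∘ u) := fun φ => by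
  rw [← Language.Formula.realize_relabel, ← Language.Formula.realize_relabel]
  exact h _

lemma SameType.sameDiagram {κ : Type*} {s t : κ → M} (h : SameType L s t) :
    SameDiagram L s t := by
  constructor
  · intro i j
    have := h ((Language.Term.var i).equal (Language.Term.var j))
    simpa using this
  · intro n R u
    have := h (R.formula fun m => Language.Term.var (u m))
    simpa [Language.Formula.realize_rel, Function.comp_def] using this

lemma mem_locus {m n : ℕ} {a : Fin m → M} {b x : Fin n → M} :
    x ∈ locus L a b ↔ SameType L (Sum.elim a x) (Sum.elim a b) := Iff.rfl

/-- There are finitely many types of `κ`-tuples over the empty set. -/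
def FinitelyManyTypes (L : FirstOrder.Language.{u, v}) (M : Type w) [L.Structure M]
    (κ : Type) : Prop :=
  ∃ (Ω : Type (max u v)) (_ : Finite Ω) (g : (κ → M) → Ω), ∀ s t, g s = g t → SameType L s t

/-- For each code whose fibre contains a tuple of another type, one formula separates `s` from that
type; the conjunction over the finitely many codes isolates. -/
lemma FinitelyManyTypes.exists_isolating {κ : Type} (h : FinitelyManyTypes L M κ) (s : κ → M) :
    ∃ φ : L.Formula κ, ∀ t : κ → M, φ.Realize t ↔ SameType L t s := by
  classical
  obtain ⟨Ω, _, g, hg⟩ := h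
  have key : ∀ o : Ω, ∃ ψ : L.Formula κ, ψ.Realize s ∧
      ∀ t, g t = o → ¬ SameType L t s → ¬ ψ.Realize t := by
    intro o
    by_cases ho : ∃ t, g t = o ∧ ¬ SameType L t s
    · obtain ⟨t, ht, hts⟩ := ho
      have : ∃ ψ : L.Formula κ, ψ.Realize s ∧ ¬ ψ.Realize t := by
        by_contra! hall
        refine hts fun ψ => ⟨fun h1 => ?_, hall ψ⟩
        by_contra h2
        exact hall (∼ψ) (by simpa using h2) h1
      obtain ⟨ψ, h1, h2⟩ := this
      exact ⟨ψ, h1, fun t' ht' _ => (hg t t' (ht.trans ht'.symm) ψ).not.1 h2⟩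
    · exact ⟨⊤, by simp, fun t h1 h2 => (ho ⟨t, h1, h2⟩).elim⟩
  choose ψ h1 h2 using key
  refine ⟨Language.Formula.iInf ψ, fun t => ?_⟩
  rw [Language.Formula.realize_iInf]
  constructor
  · intro h
    by_contra hts
    exact h2 (g t) t rfl hts (h _)
  · exact fun h o => (h _).2 (h1 o)

variable (hfin : ∀ k : ℕ, FinitelyManyTypes L M (Fin k))

include hfin in
lemma finitelyManyTypes_of_finite (κ : Type) [Finite κ] : FinitelyManyTypes L M κ := by
  obtain ⟨k, ⟨e⟩⟩ := Finite.exists_equiv_fin κ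
  obtain ⟨Ω, hΩ, g, hg⟩ := hfin k
  refine ⟨Ω, hΩ, fun s => g (s ∘ e.symm), fun s t h => ?_⟩
  have := (hg _ _ h).comp e
  rwa [Function.comp_assoc, Function.comp_assoc, e.symm_comp_self] at this

include hfin in
lemma exists_isolating {κ : Type} [Finite κ] (s : κ → M) :
    ∃ φ : L.Formula κ, ∀ t : κ → M, φ.Realize t ↔ SameType L t s :=
  (finitelyManyTypes_of_finite hfin κ).exists_isolating s

include hfin in
-- The existential closure of an isolating formula transfers from `s` to `t`.
lemma SameType.exists_elim {κ ι : Type} [Finite κ] [Finite ι] {s t : κ → M}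
    (h : SameType L s t) (y : ι → M) :
    ∃ y' : ι → M, SameType L (Sum.elim s y) (Sum.elim t y') := by
  obtain ⟨φ, hφ⟩ := exists_isolating hfin (Sum.elim s y)
  have := (h (φ.iExs ι)).1
  rw [Language.Formula.realize_iExs, Language.Formula.realize_iExs] at this
  obtain ⟨y', hy'⟩ := this ⟨y, (hφ _).2 (SameType.refl _)⟩
  exact ⟨y', ((hφ _).1 hy').symm⟩

lemma SameDiagram.embedsOn {κ : Type*} {s t : κ → M} (h : SameDiagram L s t) :
    ∃ g : M → M, EmbedsOn L g (range s) ∧ ∀ i, g (s i) = t i := by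
  classical
  let g : M → M := fun x => if h : ∃ i, s i = x then t h.choose else x
  have hg : ∀ i, g (s i) = t i := by
    intro i
    have hi : ∃ i', s i' = s i := ⟨i, rfl⟩
    simp only [g, dif_pos hi]
    exact (h.1 _ _).1 hi.choose_spec
  refine ⟨g, ⟨?_, ?_⟩, hg⟩
  · rintro _ ⟨i, rfl⟩ _ ⟨j, rfl⟩ hij
    rw [hg, hg] at hij
    exact (h.1 _ _).2 hij
  · intro n R u hu
    choose v hv using hu
    obtain rfl : s ∘ v = u := funext hv
    have : g ∘ s ∘ v = t ∘ v := funext fun m => hg _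
    rw [this]
    exact (h.2 R v).symm

variable [Fintype (Σ n, L.Relations n)] {f : ℝ → ℝ}

omit [L.Structure M] in
lemma exists_enumeration {X : Set M} (hX : X.Finite) :
    ∃ s : Fin X.ncard → M, Function.Injective s ∧ range s = X := by
  have : Finite X := hX.to_subtype
  let e := (Finite.equivFin X).symm
  refine ⟨fun i => (e i : M), Subtype.val_injective.comp e.injective, ?_⟩
  exact (e.surjective.range_comp (Subtype.val : X → M)).trans Subtype.range_coe

lemma SameDiagram.predim_range_eq {κ : Type*} {s t : κ → M} (h : SameDiagram L s t) :
    predim L (range s) = predim L (range t) := by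
  obtain ⟨g, hg, hst⟩ := h.embedsOn
  rw [← hg.predim_image, ← range_comp]
  exact congrArg (fun u => predim L (range u)) (funext hst)

variable [IsEmpty (L.Relations 0)]

include hfin in
-- A set realizing `d` for `s` has a counterpart over `t` with the same diagram, hence the same
-- predimension.
lemma SameType.dimD_range_eq (hC : ∀ X : Set M, X.Finite → InClass L f X) {κ : Type} [Finite κ]
    {s t : κ → M} (h : SameType L s t) : dimD L (range s) = dimD L (range t) := by
  have key : ∀ {s t : κ → M}, SameType L s t → dimD L (range t) ≤ dimD L (range s) := by
    intro s t h
    obtain ⟨Y, hY, hsY, hd⟩ := exists_predim_eq_dimD hC (finite_range s)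
    obtain ⟨y, -, hy⟩ := exists_enumeration hY
    obtain ⟨y', hy'⟩ := h.exists_elim hfin y
    have h1 := hy'.sameDiagram.predim_range_eq
    have h2 : range (Sum.elim s y) = Y := by
      rw [Sum.elim_range, hy, union_eq_right.2 hsY]
    rw [h2] at h1
    rw [← hd, h1]
    refine dimD_le hC (finite_range _) ?_
    rw [Sum.elim_range]
    exact subset_union_left
  exact le_antisymm (key h.symm) (key h)

lemma IsGeneric.sameType_of_sameDiagram (hrel : L.IsRelational) (hf : GoodFunction f)
    (hM : IsGeneric L f M) {κ : Type*} {k : ℕ} {s t : Fin k → M} (hst : SameDiagram L s t)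
    (hs : SelfSufficientIn L (range s)) (ht : SelfSufficientIn L (range t)) (e : κ → Fin k) :
    SameType L (s ∘ e) (t ∘ e) := by
  intro φ
  have := hM.realize_iff hrel hf φ hst hs ht e Fin.elim0
  rw [Subsingleton.elim (s ∘ Fin.elim0) default, Subsingleton.elim (t ∘ Fin.elim0) default] at this
  exact this

/-- A tuple is coded by the size of a closed set containing it, its position there, and the diagram
of that set. Sizes are bounded, so there are finitely many codes, and the code determines the type.
-/
lemma IsGeneric.finitelyManyTypes (hrel : L.IsRelational) (hf : GoodFunction f)
    (hM : IsGeneric L f M) (κ : ℕ) : FinitelyManyTypes L M (Fin κ) := by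
  obtain ⟨K, hK⟩ := hf.exists_card_bound κ
  have key : ∀ s : Fin κ → M, ∃ (k : Fin (K + 1)) (s' : Fin k → M) (e : Fin κ → Fin k),
      s = s' ∘ e ∧ SelfSufficientIn L (range s') ∧ Function.Injective s' := by
    intro s
    have hcard : (range s).ncard ≤ κ := by
      rw [← image_univ]
      refine (ncard_image_le finite_univ).trans ?_
      simp [ncard_univ]
    obtain ⟨C, hCf, hsC, hcl, -, hCK⟩ := MSHrushovski.exists_closure
      (fun _ hX => hM.inClass_of_finite hX) hK (finite_range s) hcard
    obtain ⟨s', hinj, hr⟩ := exists_enumeration hCf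
    choose e he using fun i => hr.symm ▸ hsC (mem_range_self i)
    exact ⟨⟨C.ncard, by omega⟩, s', e, funext fun i => (he i).symm, hr ▸ hcl, hinj⟩
  choose k s' e h1 h2 h3 using key
  refine ⟨ULift (Σ k : Fin (K + 1), (Fin κ → Fin k) ×
      (∀ i : (Σ n, L.Relations n), Set (Fin i.1 → Fin k))), inferInstance,
    fun s => ⟨⟨k s, e s, fun i => {u | RelMap i.2 (s' s ∘ u)}⟩⟩, fun s t hst => ?_⟩
  have hst' := congrArg ULift.down hst
  simp only at hst'
  -- Stated with free sizes so that the equality of dependent pairs can be eliminated by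
  -- substitution.
  have aux : ∀ (k₁ k₂ : Fin (K + 1)) (s₁ : Fin k₁ → M) (s₂ : Fin k₂ → M) (e₁ : Fin κ → Fin k₁)
      (e₂ : Fin κ → Fin k₂), (⟨k₁, e₁, fun i => {u | RelMap i.2 (s₁ ∘ u)}⟩ :
        Σ k : Fin (K + 1), (Fin κ → Fin k) ×
        (∀ i : (Σ n, L.Relations n), Set (Fin i.1 → Fin k))) =
        ⟨k₂, e₂, fun i => {u | RelMap i.2 (s₂ ∘ u)}⟩ → SelfSufficientIn L (range s₁) →
        SelfSufficientIn L (range s₂) → Function.Injective s₁ → Function.Injective s₂ →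
        SameType L (s₁ ∘ e₁) (s₂ ∘ e₂) := by
    intro k₁ k₂ s₁ s₂ e₁ e₂ h c₁ c₂ i₁ i₂
    obtain ⟨rfl, h⟩ := Sigma.mk.inj_iff.1 h
    obtain ⟨rfl, hR⟩ := Prod.mk.inj (eq_of_heq h)
    refine hM.sameType_of_sameDiagram hrel hf ⟨fun i j => ?_, fun n R u => ?_⟩ c₁ c₂ _
    · rw [i₁.eq_iff, i₂.eq_iff]
    · exact iff_of_eq (congrFun (congrFun hR ⟨n, R⟩) u)
  rw [h1 s, h1 t]
  exact aux _ _ _ _ _ _ hst' (h2 s) (h2 t) (h3 s) (h3 t)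

end Types

/-! ### Numerical estimates for the control function -/

section Growth

/-- A mean value inequality: to the right of `x` the derivative is at most `1 / (2 * (x + 1))`. -/
lemma GoodFunction.le_add_div {f : ℝ → ℝ} (hf : GoodFunction f)
    (hf' : ∀ x : ℝ, 0 ≤ x → derivWithin f (Set.Ioi x) x ≤ 1 / (2 * (x + 1))) {x y : ℝ}
    (hx : 0 ≤ x) (hxy : x ≤ y) : f y ≤ f x + (y - x) / (2 * (x + 1)) := by
  have hd : ∀ z ∈ Ico x y, HasDerivWithinAt f (derivWithin f (Ioi z) z) (Ici z) z := by
    intro z hz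
    exact hasDerivWithinAt_Ioi_iff_Ici.1
      (hf.differentiable_right z (hx.trans hz.1)).hasDerivWithinAt
  have hB : ∀ z, HasDerivAt (fun z => f x + (z - x) / (2 * (x + 1))) (1 / (2 * (x + 1))) z := by
    intro z
    exact (((hasDerivAt_id z).sub_const x).div_const _).const_add _
  refine image_le_of_deriv_right_le_deriv_boundary (a := x) (b := y)
    (hf.continuousOn.mono fun z hz => hx.trans hz.1) hd
    (B := fun z => f x + (z - x) / (2 * (x + 1))) (by simp)
    (fun z _ => (hB z).continuousAt.continuousWithinAt)
    (fun z _ => (hB z).hasDerivWithinAt) (fun z hz => ?_) (right_mem_Icc.2 hxy)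
  refine (hf' z (hx.trans hz.1)).trans ?_
  have := hz.1
  gcongr

/-- The numerical estimate behind the amalgamation of three extensions of a common base. -/
lemma GoodFunction.growth {f : ℝ → ℝ} (hf : GoodFunction f)
    (hf' : ∀ x : ℝ, 0 ≤ x → derivWithin f (Set.Ioi x) x ≤ 1 / (2 * (x + 1)))
    {α : ℕ} {n : Fin 3 → ℕ} {e r : ℤ} {u : Fin 3 → ℤ} (hu : ∀ i, 0 ≤ u i)
    (hun : ∀ i, 0 < n i → 0 < u i) (hfu : ∀ i, f ((α + n i : ℕ) : ℝ) ≤ ((e + u i : ℤ) : ℝ))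
    (hr : r ≤ 1) (hru : r = 1 → ∀ i, 0 < u i) :
    f ((α + ∑ i, n i : ℕ) : ℝ) ≤ ((e + ∑ i, u i - r : ℤ) : ℝ) := by
  -- Growth is measured from the largest component: `U` and `S` are the predimension and the points
  -- added by the other two, and each of these satisfies `n i ≤ n i₀ * u i`.
  obtain ⟨i₀, hi₀⟩ := Finite.exists_max n
  set U : ℤ := ∑ i ∈ Finset.univ.erase i₀, u i with hU
  set S : ℕ := ∑ i ∈ Finset.univ.erase i₀, n i with hS
  have hsn : n i₀ + S = ∑ i, n i := Finset.add_sum_erase _ _ (Finset.mem_univ _)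
  have hsu : u i₀ + U = ∑ i, u i := Finset.add_sum_erase _ _ (Finset.mem_univ _)
  have hSU : (S : ℤ) ≤ n i₀ * U := by
    rw [hS, hU, Nat.cast_sum, Finset.mul_sum]
    refine Finset.sum_le_sum fun i _ => ?_
    rcases Nat.eq_zero_or_pos (n i) with h | h
    · rw [h]
      exact mul_nonneg (Int.natCast_nonneg _) (hu i)
    · have h1 := hun i h
      have h2 : (n i : ℤ) ≤ n i₀ := by exact_mod_cast hi₀ i
      nlinarith
  have hU0 : 0 ≤ U := Finset.sum_nonneg fun i _ => hu i
  have hUr : 2 * r ≤ U := by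
    rcases hr.lt_or_eq with h | h
    · omega
    · have : ∑ i ∈ Finset.univ.erase i₀, (1 : ℤ) ≤ U :=
        Finset.sum_le_sum fun i _ => hru h i
      simp at this
      omega
  have h1 := hf.le_add_div hf' (x := ((α + n i₀ : ℕ) : ℝ)) (y := ((α + ∑ i, n i : ℕ) : ℝ))
    (by positivity) (by rw [← hsn]; exact_mod_cast (by omega : α + n i₀ ≤ α + (n i₀ + S)))
  -- So `f` grows by at most `U / 2`, and `U / 2 ≤ U - r` because `2 * r ≤ U`. The factor 2 in the
  -- derivative bound thus pays for the linking triple.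
  have h2 : (((α + ∑ i, n i : ℕ) : ℝ) - ((α + n i₀ : ℕ) : ℝ)) / (2 * (((α + n i₀ : ℕ) : ℝ) + 1))
      ≤ (U : ℝ) / 2 := by
    rw [← hsn, div_le_div_iff₀ (by positivity) (by norm_num)]
    have h3 : (S : ℝ) ≤ n i₀ * U := by exact_mod_cast hSU
    have h4 : (0 : ℝ) ≤ U := by exact_mod_cast hU0
    have h5 : (0 : ℝ) ≤ α * U := by positivity
    push_cast
    nlinarith
  have h6 := hfu i₀
  have h7 : (2 * r : ℝ) ≤ U := by exact_mod_cast hUr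
  rw [← hsu]
  push_cast at *
  linarith

end Growth

/-! ### Amalgams of three components with one linking triple -/

section Amalgam

/-- Counting in a sunflower with kernel `T`; it serves both for points and for related tuples. -/
lemma ncard_iUnion_of_inter {β : Type*} {T : Set β} {D : Fin 3 → Set β} (hD : ∀ i, (D i).Finite)
    (hT : ∀ i, T ⊆ D i) (hinter : ∀ i j, i ≠ j → D i ∩ D j ⊆ T) :
    ((⋃ i, D i).ncard : ℤ) = T.ncard + ∑ i, ((D i).ncard - T.ncard : ℤ) := by
  have hTf : T.Finite := (hD 0).subset (hT 0)
  have h1 : (⋃ i, D i) = T ∪ ⋃ i, D i \ T := by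
    ext x
    simp only [mem_iUnion, mem_union, mem_sdiff]
    constructor
    · rintro ⟨i, hi⟩
      by_cases hx : x ∈ T
      · exact Or.inl hx
      · exact Or.inr ⟨i, hi, hx⟩
    · rintro (hx | ⟨i, hi, -⟩)
      · exact ⟨0, hT 0 hx⟩
      · exact ⟨i, hi⟩
  have h2 : Pairwise (Function.onFun Disjoint fun i => D i \ T) := fun i j hij =>
    disjoint_left.2 fun x hx hx' => hx.2 (hinter i j hij ⟨hx.1, hx'.1⟩)
  rw [h1, ncard_union_eq (disjoint_left.2 ?_) hTf (finite_iUnion fun i => (hD i).sdiff),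
    ncard_iUnion_of_finite (fun i => (hD i).sdiff) h2, finsum_eq_sum_of_fintype]
  · push_cast
    congr 1
    refine Finset.sum_congr rfl fun i _ => ?_
    have := ncard_sdiff_add_ncard_of_subset (hT i) (hD i)
    omega
  · intro x hx hx'
    obtain ⟨i, hi⟩ := mem_iUnion.1 hx'
    exact hi.2 hx

variable (L : FirstOrder.Language.{u, v}) {N : Type w} [L.Structure N]

/-- The structure `N` is the free amalgam of its substructures `C i` over `A`, except that the
relation `R` holds in addition for a transversal `t`. -/
structure IsLinkedAmalgam (A : Set N) (C : Fin 3 → Set N) (R : L.Relations 3) (t : Fin 3 → N) :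
    Prop where
  subset : ∀ i, A ⊆ C i
  inter : ∀ i j, i ≠ j → C i ∩ C j ⊆ A
  cover : ⋃ i, C i = univ
  rel : ∀ p ∈ relTuples L (univ : Set N), (∃ i, ∀ k, p.2 k ∈ C i) ∨ p = ⟨⟨3, R⟩, t⟩
  rel_link : RelMap R t
  mem : ∀ i, t i ∈ C i
  notMem : ∀ i, t i ∉ A

variable {L} [Fintype (Σ n, L.Relations n)]

namespace IsLinkedAmalgam

variable [Finite N] {A : Set N} {C : Fin 3 → Set N} {R : L.Relations 3} {t : Fin 3 → N}
  (h : IsLinkedAmalgam L A C R t)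

include h

omit [Fintype (Σ n, L.Relations n)] [Finite N] in
lemma index_eq {i j : Fin 3} (hij : t i ∈ C j) : i = j := by
  by_contra hne
  exact h.notMem i (h.inter i j hne ⟨h.mem i, hij⟩)

omit [Fintype (Σ n, L.Relations n)] in
lemma ncard_eq (X : Set N) : (X.ncard : ℤ) =
    (X ∩ A).ncard + ∑ i, ((X ∩ C i).ncard - (X ∩ A).ncard : ℤ) := by
  rw [← ncard_iUnion_of_inter (fun _ => toFinite _)
    (fun i => inter_subset_inter_right X (h.subset i)), ← inter_iUnion, h.cover, inter_univ]
  exact fun i j hij x hx => ⟨hx.1.1, h.inter i j hij ⟨hx.1.2, hx.2.2⟩⟩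

-- The linking triple lies in no single component, so it is the one correction to the formula for a
-- free amalgam.
open Classical in
lemma predim_eq_sum (X : Set N) : predim L X =
    predim L (X ∩ A) + ∑ i, (predim L (X ∩ C i) - predim L (X ∩ A)) -
      if ∀ i, t i ∈ X then 1 else 0 := by
  have hfin : ∀ X : Set N, (relTuples L X).Finite := fun X => relTuples_finite L (toFinite X)
  have h1 : ((relTuples L X).ncard : ℤ) = (⋃ i, relTuples L (X ∩ C i)).ncard +
      if ∀ i, t i ∈ X then 1 else 0 := by
    have hno : (⟨⟨3, R⟩, t⟩ : Σ i : (Σ n, L.Relations n), Fin i.1 → N) ∉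
        ⋃ i, relTuples L (X ∩ C i) := by
      intro hp
      obtain ⟨i, hi⟩ := mem_iUnion.1 hp
      have h0 := h.index_eq (hi.1 (0 : Fin 3)).2
      have h1 := h.index_eq (hi.1 (1 : Fin 3)).2
      exact absurd (h0.trans h1.symm) (by decide)
    have hsub : (⋃ i, relTuples L (X ∩ C i)) ⊆ relTuples L X :=
      iUnion_subset fun i => relTuples_mono L inter_subset_left
    split_ifs with ht
    · have : relTuples L X = insert ⟨⟨3, R⟩, t⟩ (⋃ i, relTuples L (X ∩ C i)) := by
        refine Subset.antisymm (fun p hp => ?_) (insert_subset ⟨ht, h.rel_link⟩ hsub)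
        rcases h.rel p (relTuples_mono L (subset_univ _) hp) with ⟨i, hi⟩ | rfl
        · exact mem_insert_of_mem _ (mem_iUnion.2 ⟨i, fun k => ⟨hp.1 k, hi k⟩, hp.2⟩)
        · exact mem_insert _ _
      rw [this, ncard_insert_of_notMem hno (finite_iUnion fun i => hfin _)]
      push_cast
      rfl
    · have : relTuples L X = ⋃ i, relTuples L (X ∩ C i) := by
        refine Subset.antisymm (fun p hp => ?_) hsub
        rcases h.rel p (relTuples_mono L (subset_univ _) hp) with ⟨i, hi⟩ | rfl
        · exact mem_iUnion.2 ⟨i, fun k => ⟨hp.1 k, hi k⟩, hp.2⟩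
        · exact (ht hp.1).elim
      rw [this, add_zero]
  have h2 := ncard_iUnion_of_inter (fun i => hfin (X ∩ C i))
    (fun i => relTuples_mono L (inter_subset_inter_right X (h.subset i))) (by
      intro i j hij
      rw [← relTuples_inter]
      exact relTuples_mono L fun x hx => ⟨hx.1.1, h.inter i j hij ⟨hx.1.2, hx.2.2⟩⟩)
  have h3 := h.ncard_eq X
  rw [predim_eq L (toFinite X), predim_eq L (toFinite (X ∩ A)), h1, h2]
  simp only [predim_eq L (toFinite (X ∩ C _)), Fin.sum_univ_three] at h3 ⊢
  split_ifs <;> omega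

variable (hA : ∀ i, SelfSufficient L A (C i))

include hA

lemma selfSufficient_inter (X : Set N) (i : Fin 3) : SelfSufficient L (X ∩ A) (X ∩ C i) := by
  have := (hA i).inter (toFinite _) (inter_subset_right (s := X) (t := C i))
  rwa [← inter_assoc, inter_comm A X, inter_assoc, inter_eq_left.2 (h.subset i)] at this

lemma predim_lt {X : Set N} {i : Fin 3} {x : N} (hx : x ∈ X) (hxC : x ∈ C i) (hxA : x ∉ A) :
    predim L (X ∩ A) < predim L (X ∩ C i) :=
  (h.selfSufficient_inter hA X i).2 _ ⟨inter_subset_inter_right X (h.subset i),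
    fun h' => hxA (h' ⟨hx, hxC⟩).2⟩ le_rfl

lemma predim_inter_le (X : Set N) (i : Fin 3) : predim L (X ∩ A) ≤ predim L (X ∩ C i) := by
  by_cases hX : X ∩ C i ⊆ A
  · rw [show X ∩ C i = X ∩ A from Subset.antisymm (subset_inter inter_subset_left hX)
      (inter_subset_inter_right X (h.subset i))]
  · obtain ⟨x, hx, hxA⟩ := not_subset.1 hX
    exact (h.predim_lt hA hx.1 hx.2 hxA).le

/-- A set containing the whole link gains at least one in each of three components and loses one;
any other proper extension gains in some component and loses nothing. -/
lemma selfSufficient_base : SelfSufficient L A univ := by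
  classical
  refine ⟨subset_univ _, fun B hB _ => ?_⟩
  have h1 := h.predim_eq_sum B
  have h2 := h.predim_inter_le hA B
  have h3 := h2 0
  have h4 := h2 1
  have h5 := h2 2
  rw [inter_eq_right.2 hB.1, Fin.sum_univ_three] at *
  split_ifs at h1 with ht
  · have := fun i => h.predim_lt hA (ht i) (h.mem i) (h.notMem i)
    rw [inter_eq_right.2 hB.1] at this
    have h6 := this 0
    have h7 := this 1
    omega
  · obtain ⟨x, hxB, hxA⟩ := exists_of_ssubset hB
    obtain ⟨i, hi⟩ := mem_iUnion.1 (h.cover.symm ▸ mem_univ x)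
    have := h.predim_lt hA hxB hi hxA
    rw [inter_eq_right.2 hB.1] at this
    fin_cases i <;> simp only [Fin.zero_eta, Fin.mk_one, Fin.reduceFinMk] at this <;> omega

/-- Two link points gain at least two if the third is missing; if it is present, the gain is at
least three minus one. -/
lemma add_two_le_predim {X : Set N} (hAX : A ⊆ X) {i j : Fin 3} (hij : i ≠ j) (hi : t i ∈ X)
    (hj : t j ∈ X) : predim L A + 2 ≤ predim L X := by
  classical
  have h1 := h.predim_eq_sum X
  have h2 := h.predim_inter_le hA X
  have h3 := h2 0
  have h4 := h2 1
  have h5 := h2 2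
  have h6 := fun i hi => h.predim_lt hA (X := X) hi (h.mem i) (h.notMem i)
  have h7 := h6 i hi
  have h8 := h6 j hj
  rw [inter_eq_right.2 hAX, Fin.sum_univ_three] at *
  split_ifs at h1 with ht
  · have h9 := h6 0 (ht 0)
    have h10 := h6 1 (ht 1)
    have h11 := h6 2 (ht 2)
    omega
  · fin_cases i <;> fin_cases j <;>
      simp only [Fin.zero_eta, Fin.mk_one, Fin.reduceFinMk, ne_eq, not_true_eq_false] at * <;>
      omega

variable (hδ : ∀ i, predim L (C i) = predim L A + 1)

include hδ

omit hA in
lemma predim_univ : predim L (univ : Set N) = predim L A + 2 := by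
  classical
  have h1 := h.predim_eq_sum univ
  simp only [univ_inter, Fin.sum_univ_three, hδ, mem_univ, implies_true, if_true] at h1
  omega

/-- Beyond `C i`, a set containing the link gains at least one in each of the other two components
and loses only one. -/
lemma selfSufficient_component (i : Fin 3) : SelfSufficient L (C i) univ := by
  classical
  refine ⟨subset_univ _, fun B hB _ => ?_⟩
  have hAB : A ⊆ B := (h.subset i).trans hB.1
  have h1 := h.predim_eq_sum B
  have h2 := h.predim_inter_le hA B
  have h3 := h2 0
  have h4 := h2 1
  have h5 := h2 2
  have h6 : predim L (B ∩ C i) = predim L A + 1 := by rw [inter_eq_right.2 hB.1, hδ]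
  rw [hδ]
  rw [inter_eq_right.2 hAB, Fin.sum_univ_three] at *
  split_ifs at h1 with ht
  · have := fun i => h.predim_lt hA (ht i) (h.mem i) (h.notMem i)
    rw [inter_eq_right.2 hAB] at this
    have h6 := this 0
    have h7 := this 1
    have h7 := this 2
    omega
  · obtain ⟨x, hxB, hxC⟩ := exists_of_ssubset hB
    obtain ⟨j, hj⟩ := mem_iUnion.1 (h.cover.symm ▸ mem_univ x)
    have := h.predim_lt hA hxB hj fun hx => hxC (h.subset i hx)
    rw [inter_eq_right.2 hAB] at this
    have hij : i ≠ j := by rintro rfl; exact hxC hj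
    fin_cases i <;> fin_cases j <;>
      simp only [Fin.zero_eta, Fin.mk_one, Fin.reduceFinMk, ne_eq, not_true_eq_false] at * <;>
      omega

omit hδ in
lemma inClass [IsEmpty (L.Relations 0)] {f : ℝ → ℝ} (hf : GoodFunction f)
    (hf' : ∀ x : ℝ, 0 ≤ x → derivWithin f (Set.Ioi x) x ≤ 1 / (2 * (x + 1)))
    (hC : ∀ i, InClass L f (C i)) : InClass L f (univ : Set N) := by
  classical
  intro X _
  have h1 := h.predim_eq_sum X
  have h2 := h.predim_inter_le hA X
  have hlt := fun i hi => h.predim_lt hA (X := X) hi (h.mem i) (h.notMem i)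
  constructor
  · rintro ⟨x, hx⟩
    have h3 := h2 0
    have h4 := h2 1
    have h5 := h2 2
    have h0 : 0 ≤ predim L (X ∩ A) := by
      rcases (X ∩ A).eq_empty_or_nonempty with h' | h'
      · rw [h', predim_empty]
      · exact ((hC 0 (X ∩ A) (inter_subset_right.trans (h.subset 0))).1 h').le
    rw [Fin.sum_univ_three] at h1
    split_ifs at h1 with ht
    · have h6 := hlt 0 (ht 0)
      have h7 := hlt 1 (ht 1)
      omega
    · obtain ⟨i, hi⟩ := mem_iUnion.1 (h.cover.symm ▸ mem_univ x)
      have := (hC i (X ∩ C i) inter_subset_right).1 ⟨x, hx, hi⟩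
      fin_cases i <;> simp only [Fin.zero_eta, Fin.mk_one, Fin.reduceFinMk] at this <;> omega
  · have hle : ∀ i, (X ∩ A).ncard ≤ (X ∩ C i).ncard := fun i =>
      ncard_le_ncard (inter_subset_inter_right X (h.subset i)) (toFinite _)
    have := hf.growth hf' (α := (X ∩ A).ncard)
      (n := fun i => (X ∩ C i).ncard - (X ∩ A).ncard) (e := predim L (X ∩ A))
      (r := if ∀ i, t i ∈ X then 1 else 0) (u := fun i => predim L (X ∩ C i) - predim L (X ∩ A))
      (fun i => sub_nonneg.2 (h2 i)) (fun i hi => ?_) (fun i => ?_) (by split_ifs <;> simp)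
      (fun hr i => ?_)
    · rw [h1]
      convert this
      have h3 := h.ncard_eq X
      zify
      rw [h3]
      simp only [Nat.cast_sub (hle _)]
    · have : ¬ X ∩ C i ⊆ X ∩ A := fun hs => by
        have := ncard_le_ncard hs (toFinite _)
        omega
      obtain ⟨x, hx, hxA⟩ := not_subset.1 this
      exact sub_pos.2 (h.predim_lt hA hx.1 hx.2 fun h' => hxA ⟨hx.1, h'⟩)
    · have := (hC i (X ∩ C i) inter_subset_right).2
      convert this using 3
      · have := hle i
        omega
      · ring
    · split_ifs at hr with ht
      · exact sub_pos.2 (hlt i (ht i))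
      · exact absurd hr zero_ne_one

end IsLinkedAmalgam

end Amalgam

/-! ### Realizing linked triples in the generic structure -/

section Realization

variable {L : FirstOrder.Language.{u, v}} [Fintype (Σ n, L.Relations n)]
  [IsEmpty (L.Relations 0)] {M : Type w} [L.Structure M] {f : ℝ → ℝ}

/-- Any three one-point types of relative dimension one over a self-sufficient finite set have
realizations which are pairwise independent, while each of them is algebraic over the other two. -/
lemma IsGeneric.exists_linked (hrel : L.IsRelational) (hf : GoodFunction f)
    (hf' : ∀ x : ℝ, 0 ≤ x → derivWithin f (Set.Ioi x) x ≤ 1 / (2 * (x + 1)))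
    (hM : IsGeneric L f M) (R : L.Relations 3) {m : ℕ} {a : Fin m → M}
    (ha : SelfSufficientIn L (range a)) (x : Fin 3 → M)
    (hx : ∀ i, dimD L (insert (x i) (range a)) = dimD L (range a) + 1) :
    ∃ y : Fin 3 → M,
      (∀ i, SameType L (Sum.elim a fun _ : Fin 1 => y i) (Sum.elim a fun _ : Fin 1 => x i)) ∧
      (∀ i j, i ≠ j →
        dimD L (range a) + 2 ≤ dimD L (insert (y i) (insert (y j) (range a)))) ∧
      dimD L (range y ∪ range a) ≤ dimD L (range a) + 2 := by
  have hC : ∀ X : Set M, X.Finite → InClass L f X := fun _ hX => hM.inClass_of_finite hX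
  set A := range a with hAdef
  have hAf : A.Finite := finite_range a
  have hdA := ha.dimD_eq hC hAf
  have hxA : ∀ i, x i ∉ A := fun i hi => by
    have := hx i
    rw [insert_eq_of_mem hi] at this
    omega
  choose C hCf hxC hcl hCd using fun i => hM.exists_closure hf (hAf.insert (x i))
  have hAC : ∀ i, A ⊆ C i := fun i => (subset_insert _ _).trans (hxC i)
  -- Tagged copies of the three closures glued along `A`: points of `A` carry the tag 0 only, so
  -- they are not duplicated.
  let S : Set (Fin 3 × M) := {p | p.2 ∈ C p.1 ∧ (p.2 ∈ A → p.1 = 0)}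
  have hSf : S.Finite := by
    refine (finite_univ.prod (finite_iUnion hCf)).subset fun p hp => ?_
    exact ⟨mem_univ _, mem_iUnion.2 ⟨p.1, hp.1⟩⟩
  have : Finite S := hSf.to_subtype
  let ρ : S → M := fun p => p.1.2
  let D : Fin 3 → Set S := fun i => {p | p.1.2 ∈ A ∨ p.1.1 = i}
  let B : Set S := {p | p.1.2 ∈ A}
  let τ : Fin 3 → S := fun i => ⟨(i, x i), hxC i (mem_insert _ _), fun h => (hxA i h).elim⟩
  let _ : L.Structure S :=
    { funMap := fun g _ => (hrel _).elim g
      RelMap := fun {n} Q t => (RelMap Q (ρ ∘ t) ∧ ∃ i, ∀ k, t k ∈ D i) ∨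
        (⟨⟨n, Q⟩, t⟩ : Σ i : (Σ n, L.Relations n), Fin i.1 → S) = ⟨⟨3, R⟩, τ⟩ }
  have hτD : ∀ {i j}, τ i ∈ D j → i = j := fun {i j} h => h.resolve_left (hxA i)
  have hρ : ∀ i, EmbedsOn L ρ (D i) := by
    intro i
    constructor
    · intro p hp q hq hpq
      have h2 : p.1.2 = q.1.2 := hpq
      refine Subtype.ext (Prod.ext ?_ h2)
      by_cases hA : p.1.2 ∈ A
      · rw [p.2.2 hA, q.2.2 (h2 ▸ hA)]
      · rw [hp.resolve_left hA, hq.resolve_left (h2 ▸ hA)]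
    · intro n Q t ht
      refine ⟨fun h => Or.inl ⟨h, i, ht⟩, ?_⟩
      rintro (h | h)
      · exact h.1
      · cases h
        exact absurd ((hτD (ht (0 : Fin 3))).trans (hτD (ht (1 : Fin 3))).symm) (by decide)
  have hBD : ∀ i, B ⊆ D i := fun i p hp => Or.inl hp
  have hρD : ∀ i, ρ '' D i = C i := by
    intro i
    ext z
    constructor
    · rintro ⟨p, hp | rfl, rfl⟩
      · exact hAC i hp
      · exact p.2.1
    · intro hz
      by_cases hA : z ∈ A
      · exact ⟨⟨(0, z), hAC 0 hA, fun _ => rfl⟩, Or.inl hA, rfl⟩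
      · exact ⟨⟨(i, z), hz, fun h => (hA h).elim⟩, Or.inr rfl, rfl⟩
  have hρB : ρ '' B = A := by
    ext z
    constructor
    · rintro ⟨p, hp, rfl⟩
      exact hp
    · exact fun hz => ⟨⟨(0, z), hAC 0 hz, fun _ => rfl⟩, hz, rfl⟩
  have hlink : IsLinkedAmalgam L B D R τ :=
    { subset := hBD
      inter := fun i j hij p hp => by
        rcases hp with ⟨h | h, h' | h'⟩
        · exact h
        · exact h
        · exact h'
        · exact (hij (h.symm.trans h')).elim
      cover := eq_univ_of_forall fun p => mem_iUnion.2 ⟨p.1.1, Or.inr rfl⟩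
      rel := fun p hp => by
        rcases hp.2 with h | h
        · exact Or.inl h.2
        · exact Or.inr h
      rel_link := Or.inr rfl
      mem := fun i => Or.inr rfl
      notMem := fun i => hxA i }
  have hBs : ∀ i, SelfSufficient L B (D i) := by
    intro i
    refine (hρ i).selfSufficient_of_image (hBD i) ?_
    rw [hρB, hρD]
    have := ha (C i) (hCf i)
    rwa [inter_eq_left.2 (hAC i)] at this
  have hpB : predim L B = dimD L A := by
    rw [← ((hρ 0).mono (hBD 0)).predim_image, hρB, hdA]
  have hδ : ∀ i, predim L (D i) = predim L B + 1 := by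
    intro i
    rw [← (hρ i).predim_image, hρD, hCd, hx, hpB]
  have hclass : InClass L f (univ : Set S) := by
    refine hlink.inClass hBs hf hf' fun i => (hρ i).inClass_of_image ?_
    rw [hρD]
    exact hC _ (hCf i)
  obtain ⟨β, hβ, hβB⟩ := hM.exists_extension hrel hclass (hlink.selfSufficient_base hBs)
    ((hρ 0).mono (hBD 0)) (by rw [hρB]; exact ha)
  have hβe : ∀ X : Set S, EmbedsOn L β X := embedsOn_embedding β
  refine ⟨fun i => β (τ i), fun i => ?_, fun i j hij => ?_, ?_⟩
  -- The component `D i` is closed both in its image under `β` and in its original position `C i`,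
  -- with the same diagram; hence its points keep their types over `a`.
  · obtain ⟨σ, hσ, hσr⟩ := exists_enumeration (toFinite (D i))
    have hsd : SameDiagram L (β ∘ σ) (ρ ∘ σ) := by
      have hσD : ∀ k, σ k ∈ D i := fun k => hσr ▸ mem_range_self k
      constructor
      · intro k l
        simp only [Function.comp]
        rw [β.injective.eq_iff]
        exact ⟨congrArg ρ, fun h => (hρ i).1 (hσD k) (hσD l) h⟩
      · intro n Q u
        exact (β.map_rel Q (σ ∘ u)).trans ((hρ i).2 Q (σ ∘ u) fun k => hσD _).symm
    have hr1 : SelfSufficientIn L (range (β ∘ σ)) := by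
      rw [range_comp, hσr]
      refine SelfSufficientIn.of_selfSufficient (finite_range β) ?_ hβ
      rw [← image_univ]
      exact (hβe univ).selfSufficient (hlink.selfSufficient_component hBs hδ i)
    have hr2 : SelfSufficientIn L (range (ρ ∘ σ)) := by
      rw [range_comp, hσr, hρD]
      exact hcl i
    have haD : ∀ k, (⟨(0, a k), hAC 0 (mem_range_self k), fun _ => rfl⟩ : S) ∈ range σ :=
      fun k => by rw [hσr]; exact Or.inl (mem_range_self k)
    choose e he using haD
    obtain ⟨z, hz⟩ : τ i ∈ range σ := by rw [hσr]; exact hlink.mem i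
    have := hM.sameType_of_sameDiagram hrel hf hsd hr1 hr2 (Sum.elim e fun _ : Fin 1 => z)
    convert this using 1
    · rw [Sum.comp_elim]
      congr 1
      · funext k
        simp only [Function.comp, he]
        exact (hβB ⟨(0, a k), _⟩ (show a k ∈ A from mem_range_self k)).symm
      · funext k
        simp only [Function.comp, hz]
    · rw [Sum.comp_elim]
      congr 1
      · funext k
        simp only [Function.comp, he, ρ]
      · funext k
        simp only [Function.comp, hz, ρ, τ]
  -- Since the image of `β` is closed, cutting a set down to it does not raise the predimension, so
  -- the bound can be checked inside the amalgam.
  · refine le_dimD ((hAf.insert _).insert _) fun Y hY hsub => ?_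
    have h1 := hβ.predim_inter_le hY
    rw [inter_comm, ← image_preimage_eq_inter_range, (hβe _).predim_image] at h1
    refine le_trans ?_ h1
    rw [← hpB]
    refine hlink.add_two_le_predim hBs (fun p hp => ?_) hij (hsub (mem_insert _ _))
      (hsub (mem_insert_of_mem _ (mem_insert _ _)))
    change β p ∈ Y
    rw [hβB p hp]
    exact hsub (mem_insert_of_mem _ (mem_insert_of_mem _ hp))
  · have h1 : range (fun i => β (τ i)) ∪ A ⊆ range β := by
      refine union_subset (range_subset_iff.2 fun i => mem_range_self _) ?_
      rw [← hρB]
      rintro _ ⟨p, hp, rfl⟩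
      exact ⟨p, hβB p hp⟩
    refine (dimD_le hC (finite_range β) h1).trans ?_
    rw [← image_univ, (hβe _).predim_image, hlink.predim_univ hδ, hpB]

end Realization

/-! ### Dimension-measure functions on loci -/

section Dimension

variable {L : FirstOrder.Language.{u, v}} {M : Type w} [L.Structure M]

lemma definable_realize {κ ι : Type*} (φ : L.Formula (κ ⊕ ι)) (a : ι → M) :
    (univ : Set M).Definable L {x : κ → M | φ.Realize (Sum.elim x a)} := by
  rw [definable_iff_exists_formula_sum]
  refine ⟨φ.relabel (Sum.elim Sum.inr fun i => Sum.inl ⟨a i, mem_univ _⟩), ?_⟩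
  ext x
  simp only [mem_ofPred_eq, Language.Formula.realize_relabel, Sum.comp_elim]
  rfl

lemma definable_graph_comp {n m : ℕ} {X : Set (Fin n → M)} (hX : (univ : Set M).Definable L X)
    (σ : Fin m → Fin n) : (univ : Set M).Definable L
      {z : Fin n ⊕ Fin m → M | z ∘ Sum.inl ∈ X ∧ (z ∘ Sum.inl) ∘ σ = z ∘ Sum.inr} := by
  refine (hX.preimage_comp (Sum.inl : Fin n → Fin n ⊕ Fin m)).inter ?_
  refine Definable.mono (A := ∅) ?_ (empty_subset _)
  refine empty_definable_iff.2 ⟨Language.Formula.iInf fun i : Fin m =>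
    (Language.Term.var (Sum.inl (σ i))).equal (Language.Term.var (Sum.inr i)), ?_⟩
  ext z
  simp only [mem_ofPred_eq, Language.Formula.realize_iInf, Language.Formula.realize_equal,
    Language.Term.realize_var, funext_iff, Function.comp_apply]
  exact Iff.rfl

namespace DimensionMeasure

variable (h : DimensionMeasure L M)

lemma dim_singleton {n : ℕ} (hn : 0 < n) (x : Fin n → M) :
    h.dim {x} = 0 ∧ h.mu {x} = 1 := by
  have := h.finite_sets hn {x} (finite_singleton x) (singleton_nonempty x)
  simpa using this

/-- The fibre axiom for the identity map, whose fibres are points of dimension 0. -/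
lemma dim_eq_sup {n r : ℕ} (hn : 0 < n) {Y : Set (Fin n → M)} (hY : (univ : Set M).Definable L Y)
    (hne : Y.Nonempty) {Z : Fin r → Set (Fin n → M)}
    (hZ : ∀ i, (univ : Set M).Definable L (Z i)) (hZne : ∀ i, (Z i).Nonempty)
    (hdisj : Pairwise fun i j => Disjoint (Z i) (Z j)) (hU : ⋃ i, Z i = Y) :
    h.dim Y = Finset.univ.sup fun i => h.dim (Z i) := by
  have := (h.fubini hn hn Y Y id hY hne hY (image_id Y) (definable_graph_comp hY id) r Z
    (fun _ => 0) (fun _ => 1) hZ hZne hdisj hU fun i y hy => ?_).1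
  · simpa using this
  · have hyY : y ∈ Y := hU ▸ mem_iUnion.2 ⟨i, hy⟩
    have : {x ∈ Y | id x = y} = {y} := by
      ext x
      simp only [id, mem_ofPred_eq, mem_singleton_iff]
      exact ⟨fun h => h.2, fun h => ⟨h ▸ hyY, h⟩⟩
    rw [this]
    exact h.dim_singleton hn y

lemma dim_mono {n : ℕ} (hn : 0 < n) {X Y : Set (Fin n → M)} (hX : (univ : Set M).Definable L X)
    (hY : (univ : Set M).Definable L Y) (hne : X.Nonempty) (hXY : X ⊆ Y) :
    h.dim X ≤ h.dim Y := by
  rcases (Y \ X).eq_empty_or_nonempty with h0 | h0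
  · rw [hXY.antisymm (sdiff_eq_empty.1 h0)]
  · have := h.dim_eq_sup hn hY (hne.mono hXY) (Z := ![X, Y \ X])
      (by simpa [Fin.forall_fin_two] using ⟨hX, hY.sdiff hX⟩)
      (by simpa [Fin.forall_fin_two] using ⟨hne, h0⟩)
      (by
        intro i j hij
        fin_cases i <;> fin_cases j <;> simp at hij ⊢
        · exact disjoint_sdiff_right
        · exact disjoint_sdiff_left)
      (by
        ext x
        simp only [mem_iUnion, Fin.exists_fin_two]
        constructor
        · rintro (hx | hx)
          · exact hXY hx
          · exact hx.1
        · intro hx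
          by_cases hxX : x ∈ X
          · exact Or.inl hxX
          · exact Or.inr ⟨hx, hxX⟩)
    rw [this]
    exact Finset.le_sup (f := fun i => h.dim ((![X, Y \ X] : Fin 2 → Set (Fin n → M)) i))
      (Finset.mem_univ 0)

/-- The dimension formula for a coordinate map all of whose fibres have the same dimension and
measure. -/
lemma dim_eq_add {n m : ℕ} (hn : 0 < n) (hm : 0 < m) {X : Set (Fin n → M)}
    (hX : (univ : Set M).Definable L X) (hne : X.Nonempty) (σ : Fin m → Fin n) {d : ℕ} {c : ℝ}
    (hfib : ∀ y ∈ (fun x : Fin n → M => x ∘ σ) '' X,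
      h.dim {x ∈ X | x ∘ σ = y} = d ∧ h.mu {x ∈ X | x ∘ σ = y} = c) :
    h.dim X = d + h.dim ((fun x : Fin n → M => x ∘ σ) '' X) := by
  have hY := hX.image_comp σ
  have := (h.fubini hn hm X _ (fun x => x ∘ σ) hX hne hY rfl (definable_graph_comp hX σ) 1
    (fun _ => (fun x : Fin n → M => x ∘ σ) '' X) (fun _ => d) (fun _ => c) (fun _ => hY)
    (fun _ => hne.image _) (fun i j hij => (hij (Subsingleton.elim i j)).elim) (iUnion_const _)
    fun _ => hfib).1
  simpa using this

lemma dim_image_of_injOn {n m : ℕ} (hn : 0 < n) (hm : 0 < m) {X : Set (Fin n → M)}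
    (hX : (univ : Set M).Definable L X) (hne : X.Nonempty) (σ : Fin m → Fin n)
    (hinj : InjOn (fun x : Fin n → M => x ∘ σ) X) :
    h.dim X = h.dim ((fun x : Fin n → M => x ∘ σ) '' X) := by
  rw [h.dim_eq_add hn hm hX hne σ (d := 0) (c := 1), zero_add]
  rintro _ ⟨x, hx, rfl⟩
  have : {x' ∈ X | x' ∘ σ = x ∘ σ} = {x} := by
    ext x'
    simp only [mem_ofPred_eq, mem_singleton_iff]
    exact ⟨fun h => hinj h.1 hx h.2, by rintro rfl; exact ⟨hx, rfl⟩⟩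
  simp only [this]
  exact h.dim_singleton hn x

/-- The set of parameters giving a fixed value is definable without parameters, so it is closed
under equality of types. -/
lemma dim_eq_of_sameType {n : ℕ} (hn : 0 < n) {κ : Type*} [Finite κ]
    (θ : L.Formula (Fin n ⊕ κ)) {s t : κ → M} (hst : SameType L s t)
    (hne : {x : Fin n → M | θ.Realize (Sum.elim x s)}.Nonempty) :
    h.dim {x : Fin n → M | θ.Realize (Sum.elim x t)} =
        h.dim {x : Fin n → M | θ.Realize (Sum.elim x s)} ∧
      h.mu {x : Fin n → M | θ.Realize (Sum.elim x t)} =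
        h.mu {x : Fin n → M | θ.Realize (Sum.elim x s)} := by
  obtain ⟨k, ⟨e⟩⟩ := Finite.exists_equiv_fin κ
  have hrel : ∀ (s : κ → M) (x : Fin n → M), (θ.relabel (Sum.map id e)).Realize
      (Sum.elim x (s ∘ e.symm)) ↔ θ.Realize (Sum.elim x s) := by
    intro s x
    rw [Language.Formula.realize_relabel, Sum.elim_comp_map, Function.comp_id,
      Function.comp_assoc, e.symm_comp_self, Function.comp_id]
  obtain ⟨χ, hχ⟩ := empty_definable_iff.1 (h.definable_values hn (θ.relabel (Sum.map id e))
    (h.dim {x : Fin n → M | θ.Realize (Sum.elim x s)})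
    (h.mu {x : Fin n → M | θ.Realize (Sum.elim x s)}))
  have hs : s ∘ e.symm ∈ Set.ofPred χ.Realize := by
    rw [← hχ]
    simp only [mem_ofPred_eq, hrel, and_true]
    exact hne
  have ht : t ∘ e.symm ∈ Set.ofPred χ.Realize := ((hst.comp e.symm) χ).1 hs
  rw [← hχ] at ht
  simp only [mem_ofPred_eq, hrel] at ht
  exact ht.2

end DimensionMeasure

lemma self_mem_locus {m n : ℕ} (a : Fin m → M) (b : Fin n → M) : b ∈ locus L a b :=
  mem_locus.2 (SameType.refl _)

lemma locus_eq_of_mem {m n : ℕ} {a : Fin m → M} {b c : Fin n → M} (h : c ∈ locus L a b) :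
    locus L a c = locus L a b := by
  ext x
  exact ⟨fun hx => SameType.trans hx h, fun hx => SameType.trans hx (SameType.symm h)⟩

lemma sameType_append {m j : ℕ} {κ : Type*} {a a' : Fin m → M} {b b' : Fin j → M} {c c' : κ → M} :
    SameType L (Sum.elim (Fin.append a b) c) (Sum.elim (Fin.append a' b') c') ↔
      SameType L (Sum.elim (Sum.elim a b) c) (Sum.elim (Sum.elim a' b') c') := by
  constructor
  · intro h
    have := h.comp (Sum.map finSumFinEquiv id)
    convert this using 1 <;>
    · ext i
      rcases i with (i | i) | i <;> simp
  · intro h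
    have := h.comp (Sum.map finSumFinEquiv.symm id)
    convert this using 1 <;>
    · ext i
      rcases i with i | i
      · refine Fin.addCases (fun i => ?_) (fun i => ?_) i <;> simp
      · simp

variable (hfin : ∀ k : ℕ, FinitelyManyTypes L M (Fin k))

include hfin

lemma definable_locus {m n : ℕ} (a : Fin m → M) (b : Fin n → M) :
    (univ : Set M).Definable L (locus L a b) := by
  obtain ⟨φ, hφ⟩ := exists_isolating hfin (Sum.elim a b)
  convert definable_realize (φ.relabel Sum.swap) a using 1
  ext x
  have : Sum.elim x a ∘ Sum.swap = Sum.elim a x := by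
    funext i
    rcases i with i | i <;> rfl
  rw [mem_locus, mem_ofPred_eq, Language.Formula.realize_relabel, this, hφ]

lemma image_comp_locus {m n j : ℕ} (a : Fin m → M) (s : Fin n → M) (σ : Fin j → Fin n) :
    (fun x : Fin n → M => x ∘ σ) '' locus L a s = locus L a (s ∘ σ) := by
  ext y
  constructor
  · rintro ⟨x, hx, rfl⟩
    have := SameType.comp (mem_locus.1 hx) (Sum.map id σ)
    simp only [Sum.elim_comp_map, Function.comp_id] at this
    exact this
  · intro hy
    obtain ⟨x, hx⟩ := (SameType.symm (mem_locus.1 hy)).exists_elim hfin s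
    have hd := hx.sameDiagram.1
    refine ⟨x, ?_, ?_⟩
    · have := hx.comp (Sum.elim (Sum.inl ∘ Sum.inl) Sum.inr : Fin m ⊕ Fin n → _)
      simp only [Sum.comp_elim] at this
      exact this.symm
    · funext i
      exact (hd (Sum.inr (σ i)) (Sum.inl (Sum.inr i))).1 rfl

lemma image_comp_fibre {m n j l : ℕ} (a : Fin m → M) (s : Fin n → M) (σ : Fin j → Fin n)
    (σ' : Fin l → Fin n) :
    (fun x : Fin n → M => x ∘ σ') '' {x ∈ locus L a s | x ∘ σ = s ∘ σ} =
      locus L (Fin.append a (s ∘ σ)) (s ∘ σ') := by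
  ext y
  rw [mem_locus, sameType_append]
  constructor
  · rintro ⟨x, ⟨hx, hxσ⟩, rfl⟩
    have := SameType.comp (mem_locus.1 hx)
      (Sum.elim (Sum.elim Sum.inl (Sum.inr ∘ σ)) (Sum.inr ∘ σ'))
    simp only [Sum.comp_elim, Sum.elim_comp_inl, ← Function.comp_assoc, Sum.elim_comp_inr,
      hxσ] at this
    exact this
  · intro hy
    obtain ⟨x, hx⟩ := hy.symm.exists_elim hfin s
    have hd := hx.sameDiagram.1
    refine ⟨x, ⟨?_, ?_⟩, ?_⟩
    · have := hx.comp (Sum.elim (Sum.inl ∘ Sum.inl ∘ Sum.inl) Sum.inr : Fin m ⊕ Fin n → _)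
      simp only [Sum.comp_elim] at this
      exact this.symm
    · funext i
      exact (hd (Sum.inr (σ i)) (Sum.inl (Sum.inl (Sum.inr i)))).1 rfl
    · funext i
      exact (hd (Sum.inr (σ' i)) (Sum.inl (Sum.inr i))).1 rfl

/-- The dimension formula for a coordinate map on a locus. -/
lemma DimensionMeasure.dim_locus_eq_add (h : DimensionMeasure L M) {m n j : ℕ} (hn : 0 < n)
    (hj : 0 < j) (a : Fin m → M) (s : Fin n → M) (σ : Fin j → Fin n) :
    h.dim (locus L a s) =
      h.dim {x ∈ locus L a s | x ∘ σ = s ∘ σ} + h.dim (locus L a (s ∘ σ)) := by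
  -- The isolating formula presents all fibres as one family in `y`. The relevant `y` have the same
  -- type over `a`, so all fibres have the same dimension and measure.
  obtain ⟨θ, hθ⟩ := exists_isolating hfin (Sum.elim s (Sum.elim a (s ∘ σ)))
  have hset : ∀ y : Fin j → M, {x ∈ locus L a s | x ∘ σ = y} =
      {x | θ.Realize (Sum.elim x (Sum.elim a y))} := by
    intro y
    ext x
    simp only [mem_ofPred_eq, hθ]
    constructor
    · rintro ⟨hx, rfl⟩
      have := SameType.comp (mem_locus.1 hx) (Sum.elim Sum.inr (Sum.elim Sum.inl (Sum.inr ∘ σ)))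
      simpa only [Sum.comp_elim, Sum.elim_comp_inl, ← Function.comp_assoc,
        Sum.elim_comp_inr] using this
    · intro hx
      constructor
      · have := hx.comp (Sum.elim (Sum.inr ∘ Sum.inl) Sum.inl : Fin m ⊕ Fin n → _)
        simp only [Sum.comp_elim] at this
        exact this
      · funext i
        exact (hx.sameDiagram.1 (Sum.inl (σ i)) (Sum.inr (Sum.inr i))).2 rfl
  rw [h.dim_eq_add hn hj (definable_locus hfin a s) ⟨s, self_mem_locus a s⟩ σ
    (d := h.dim {x ∈ locus L a s | x ∘ σ = s ∘ σ}) (c := h.mu {x ∈ locus L a s | x ∘ σ = s ∘ σ}),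
    image_comp_locus hfin]
  intro y hy
  rw [image_comp_locus hfin] at hy
  rw [hset, hset]
  refine h.dim_eq_of_sameType hn θ (SameType.symm (mem_locus.1 hy)) ?_
  rw [← hset]
  exact ⟨s, self_mem_locus a s, rfl⟩

/-- On the fibre over `s ∘ σ` the coordinates outside `σ` determine the point, so the fibre projects
injectively onto the locus of `s ∘ σ'` over the enlarged parameters. -/
lemma DimensionMeasure.dim_locus_add (h : DimensionMeasure L M) {m n j l : ℕ} (hn : 0 < n)
    (hj : 0 < j) (hl : 0 < l) (a : Fin m → M) (s : Fin n → M) (σ : Fin j → Fin n)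
    (σ' : Fin l → Fin n) (hcov : ∀ k, k ∈ range σ ∨ k ∈ range σ') :
    h.dim (locus L a s) =
      h.dim (locus L a (s ∘ σ)) + h.dim (locus L (Fin.append a (s ∘ σ)) (s ∘ σ')) := by
  rw [h.dim_locus_eq_add hfin hn hj a s σ, add_comm, ← image_comp_fibre hfin,
    ← h.dim_image_of_injOn hn hl]
  · obtain ⟨θ, hθ⟩ := exists_isolating hfin (Sum.elim s (Sum.elim a (s ∘ σ)))
    convert (definable_locus hfin a s).inter (definable_realize (Language.Formula.iInf
      fun i : Fin j => (Language.Term.var (L := L) (Sum.inl (σ i) : Fin n ⊕ Fin j)).equal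
        (Language.Term.var (Sum.inr i))) (s ∘ σ)) using 1
    ext x
    simp only [mem_ofPred_eq, mem_inter_iff, Language.Formula.realize_iInf,
      Language.Formula.realize_equal, Language.Term.realize_var, funext_iff, Sum.elim_inl,
      Sum.elim_inr, Function.comp_apply]
  · exact ⟨s, self_mem_locus a s, rfl⟩
  · intro x hx x' hx' hxx
    funext k
    rcases hcov k with ⟨i, rfl⟩ | ⟨i, rfl⟩
    · exact congrFun (hx.2.trans hx'.2.symm) i
    · exact congrFun hxx i

/-- The loci over `a` form a finite definable partition, and the dimension of the whole space is the
largest of theirs. -/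
lemma DimensionMeasure.exists_dim_locus_eq [Nonempty M] (h : DimensionMeasure L M) {m n : ℕ}
    (hn : 0 < n) (a : Fin m → M) :
    ∃ z : Fin n → M, h.dim (locus L a z) = h.dim (univ : Set (Fin n → M)) := by
  have hS : (range fun z : Fin n → M => locus L a z).Finite := by
    obtain ⟨Ω, _, g, hg⟩ := finitelyManyTypes_of_finite hfin (Fin m ⊕ Fin n)
    have : ∀ z : Fin n → M, locus L a z ∈
        range fun o : Ω => {x : Fin n → M | ∃ z, g (Sum.elim a z) = o ∧ x ∈ locus L a z} := by
      intro z
      refine ⟨g (Sum.elim a z), ?_⟩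
      ext x
      constructor
      · rintro ⟨z', hz', hx⟩
        exact SameType.trans hx (hg _ _ hz')
      · exact fun hx => ⟨z, rfl, hx⟩
    exact (finite_range _).subset (range_subset_iff.2 this)
  obtain ⟨Z, hZ, hZr⟩ := exists_enumeration hS
  have hZ' : ∀ i, ∃ z, locus L a z = Z i := fun i => by
    have : Z i ∈ range fun z : Fin n → M => locus L a z := hZr ▸ mem_range_self i
    exact this
  choose z hz using hZ'
  have hU : ⋃ i, Z i = univ := by
    refine eq_univ_of_forall fun x => ?_
    have : locus L a x ∈ range Z := by rw [hZr]; exact mem_range_self x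
    obtain ⟨i, hi⟩ := this
    exact mem_iUnion.2 ⟨i, hi ▸ self_mem_locus a x⟩
  have hdim := h.dim_eq_sup hn definable_univ univ_nonempty (Z := Z)
    (fun i => hz i ▸ definable_locus hfin a (z i)) (fun i => ⟨z i, hz i ▸ self_mem_locus a _⟩)
    (fun i j hij => disjoint_left.2 fun x hi hj => hij (hZ ?_)) hU
  · obtain ⟨x⟩ : Nonempty (Fin n → M) := inferInstance
    obtain ⟨i, -⟩ := mem_iUnion.1 (hU.symm ▸ mem_univ x)
    obtain ⟨k, -, hk⟩ := Finset.exists_mem_eq_sup Finset.univ ⟨i, Finset.mem_univ i⟩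
      fun i => h.dim (Z i)
    exact ⟨z k, by rw [hz, hdim, hk]⟩
  · rw [← hz] at hi hj
    rw [← hz, ← hz, ← locus_eq_of_mem hi, locus_eq_of_mem hj]

end Dimension

/-! ### Comparing the dimension with `d` -/

section Rank

variable {L : FirstOrder.Language.{u, v}} {M : Type w} [L.Structure M]

lemma locus_subset_locus_comp {m n k : ℕ} (a : Fin m → M) (u : Fin k → Fin m) (b : Fin n → M) :
    locus L a b ⊆ locus L (a ∘ u) b := fun x hx => by
  have := SameType.comp (mem_locus.1 hx) (Sum.map u id)
  simp only [Sum.elim_comp_map, Function.comp_id] at this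
  exact this

lemma range_append {m n : ℕ} {α : Type*} (a : Fin m → α) (b : Fin n → α) :
    range (Fin.append a b) = range a ∪ range b := by
  have : Fin.append a b = Sum.elim a b ∘ finSumFinEquiv.symm := by
    funext i
    refine Fin.addCases (fun i => ?_) (fun i => ?_) i <;> simp
  rw [this, finSumFinEquiv.symm.surjective.range_comp, Sum.elim_range]

variable [Fintype (Σ n, L.Relations n)] [IsEmpty (L.Relations 0)] {f : ℝ → ℝ}

/-- By invariance of `d` under types, each coordinate of `x` leaves `d(B)` unchanged when added to
`B`, so it lies in a fixed finite closure of `B`. -/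
lemma finite_of_dimD_eq (hf : GoodFunction f) (hM : IsGeneric L f M)
    (hfin : ∀ k : ℕ, FinitelyManyTypes L M (Fin k)) {m n : ℕ} (a : Fin m → M) (s : Fin n → M)
    {B : Set M} (hB : B.Finite) (hd : dimD L (range s ∪ range a) = dimD L B) :
    {x ∈ locus L a s | B ⊆ range x ∪ range a}.Finite := by
  have hC : ∀ X : Set M, X.Finite → InClass L f X := fun _ hX => hM.inClass_of_finite hX
  obtain ⟨C, hCf, hBC, hcl, -⟩ := hM.exists_closure hf hB
  refine (Set.Finite.pi' fun _ : Fin n => hCf).subset fun x hx k => ?_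
  have h1 := (SameType.dimD_range_eq hfin hC (mem_locus.1 hx.1))
  rw [Sum.elim_range, Sum.elim_range, union_comm, union_comm (range a), hd] at h1
  have h2 := dimD_mono hC ((finite_range x).union (finite_range a))
    (insert_subset (Or.inl (mem_range_self k)) hx.2)
  have h3 := dimD_mono hC (hB.insert (x k)) (subset_insert _ _)
  exact mem_closure_of_dimD_eq hC hCf hBC hcl (by omega) hB

namespace DimensionMeasure

variable (h : DimensionMeasure L M) (hf : GoodFunction f) (hM : IsGeneric L f M)
  (hfin : ∀ k : ℕ, FinitelyManyTypes L M (Fin k))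

include hf hM hfin

lemma dim_locus_eq_zero {m n : ℕ} (hn : 0 < n) (a : Fin m → M) (b : Fin n → M)
    (hd : dimD L (range b ∪ range a) = dimD L (range a)) : h.dim (locus L a b) = 0 := by
  refine (h.finite_sets hn _ ?_ ⟨b, self_mem_locus a b⟩).1
  refine (finite_of_dimD_eq hf hM hfin a b (finite_range a) hd).subset fun x hx => ?_
  exact ⟨hx, subset_union_right⟩

lemma dim_locus_comp_eq {m n j : ℕ} (hn : 0 < n) (hj : 0 < j) (a : Fin m → M) (s : Fin n → M)
    (σ : Fin j → Fin n)
    (hd : dimD L (range s ∪ range a) = dimD L (range (s ∘ σ) ∪ range a)) :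
    h.dim (locus L a s) = h.dim (locus L a (s ∘ σ)) := by
  rw [h.dim_locus_eq_add hfin hn hj a s σ, (h.finite_sets hn _ ?_ ?_).1, zero_add]
  · refine (finite_of_dimD_eq hf hM hfin a s ((finite_range (s ∘ σ)).union (finite_range a))
      hd).subset fun x hx => ⟨hx.1, ?_⟩
    rw [← hx.2]
    exact union_subset_union_left _ (range_comp_subset_range σ x)
  · exact ⟨s, self_mem_locus a s, rfl⟩

omit [Fintype (Σ n, L.Relations n)] [IsEmpty (L.Relations 0)] hf hM in
lemma dim_locus_le_dim_univ {m n : ℕ} (hn : 0 < n) (a : Fin m → M) (b : Fin n → M) :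
    h.dim (locus L a b) ≤ h.dim (univ : Set (Fin n → M)) :=
  h.dim_mono hn (definable_locus hfin a b) definable_univ ⟨b, self_mem_locus a b⟩ (subset_univ _)

omit [Fintype (Σ n, L.Relations n)] [IsEmpty (L.Relations 0)] hf hM in
lemma dim_locus_le_of_comp {m n k : ℕ} (hn : 0 < n) (a : Fin m → M) (u : Fin k → Fin m)
    (b : Fin n → M) : h.dim (locus L a b) ≤ h.dim (locus L (a ∘ u) b) :=
  h.dim_mono hn (definable_locus hfin a b) (definable_locus hfin _ b) ⟨b, self_mem_locus a b⟩
    (locus_subset_locus_comp a u b)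

/-- All one-point types of relative dimension one have the same dimension. -/
lemma dim_locus_eq_dim_univ (hrel : L.IsRelational) (R : L.Relations 3)
    (hf' : ∀ x : ℝ, 0 ≤ x → derivWithin f (Set.Ioi x) x ≤ 1 / (2 * (x + 1)))
    {m : ℕ} (a : Fin m → M) (b : Fin 1 → M)
    (hd : dimD L (range b ∪ range a) = dimD L (range a) + 1) :
    h.dim (locus L a b) = h.dim (univ : Set (Fin 1 → M)) := by
  have hC : ∀ X : Set M, X.Finite → InClass L f X := fun _ hX => hM.inClass_of_finite hX
  have : Nonempty M := ⟨b 0⟩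
  have hrange : ∀ c : Fin 1 → M, ∀ X : Set M, range c ∪ X = insert (c 0) X := fun c X => by
    rw [range_unique]
    rfl
  refine le_antisymm (h.dim_locus_le_dim_univ hfin one_pos a b) ?_
  let S : Set ℕ := {d | ∃ (m : ℕ) (a : Fin m → M) (b : Fin 1 → M),
    dimD L (range b ∪ range a) = dimD L (range a) + 1 ∧ h.dim (locus L a b) = d}
  have hS : S.Nonempty := ⟨_, m, a, b, hd, rfl⟩
  have hmin : ∀ {m : ℕ} (a : Fin m → M) (b : Fin 1 → M),
      dimD L (range b ∪ range a) = dimD L (range a) + 1 → sInf S ≤ h.dim (locus L a b) :=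
    fun a b hab => Nat.sInf_le ⟨_, a, b, hab, rfl⟩
  refine le_trans ?_ (hmin a b hd)
  clear hd
  obtain ⟨m, a, b, hd, hab⟩ := Nat.sInf_mem hS
  -- Replacing the parameters by their closure keeps the rank equal to one. More parameters cannot
  -- raise the dimension, and minimality prevents it from falling.
  obtain ⟨C, hCf, haC, hcl, hCd⟩ := hM.exists_closure hf (finite_range a)
  obtain ⟨k, a', rfl⟩ : ∃ (k : ℕ) (a' : Fin k → M), range a' = C :=
    ⟨_, (exists_enumeration hCf).imp fun _ h => h.2⟩
  choose u hu using fun i => haC (mem_range_self i)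
  have hau : a = a' ∘ u := (funext hu).symm
  have hdC : dimD L (range a') = dimD L (range a) := by rw [hcl.dimD_eq hC hCf, hCd]
  have hd' : dimD L (range b ∪ range a') = dimD L (range a') + 1 := by
    refine le_antisymm ?_ ?_
    · rw [hrange]
      exact dimD_insert_le hC hCf _
    · rw [hdC, ← hd]
      exact dimD_mono hC ((finite_range b).union hCf) (union_subset_union_right _ haC)
  have hab' : h.dim (locus L a' b) = sInf S := by
    refine le_antisymm ?_ (hmin a' b hd')
    rw [← hab, hau]
    exact h.dim_locus_le_of_comp hfin one_pos a' u b
  obtain ⟨z, hz⟩ := h.exists_dim_locus_eq hfin one_pos a'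
  rw [← hz]
  have hz1 := dimD_insert_le hC hCf (z 0)
  have hz2 := dimD_mono hC (hCf.insert (z 0)) (subset_insert _ _)
  by_cases hzd : dimD L (insert (z 0) (range a')) = dimD L (range a')
  · rw [h.dim_locus_eq_zero hf hM hfin one_pos a' z (by rw [hrange, hzd])]
    exact Nat.zero_le _
  -- Two realizations of the minimal type are linked to one of the type of maximal dimension.
  obtain ⟨y, hy1, hy2, hy3⟩ := hM.exists_linked hrel hf hf' R hcl ![b 0, b 0, z 0] (by
    rw [hrange] at hd'
    intro i
    fin_cases i
    · exact hd'
    · exact hd'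
    · change dimD L (insert (z 0) (range a')) = _
      omega)
  have hconst : ∀ c : Fin 1 → M, (fun _ => c 0) = c := fun c =>
    funext fun i => congrArg c (Subsingleton.elim _ _)
  have hy0 : locus L a' (fun _ : Fin 1 => y 0) = locus L a' b := by
    rw [← hconst b]
    exact locus_eq_of_mem (hy1 0)
  have hyb : locus L a' (fun _ : Fin 1 => y 1) = locus L a' b := by
    rw [← hconst b]
    exact locus_eq_of_mem (hy1 1)
  have hyz : locus L a' (fun _ : Fin 1 => y 2) = locus L a' z := by
    rw [← hconst z]
    exact locus_eq_of_mem (hy1 2)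
  -- The remaining point is algebraic over `a'`, `y i` and `y 1`, so only this pair counts. Over
  -- `a'` and `y i` the point `y 1` still has rank one, so its dimension is squeezed to the minimum.
  have hpair : ∀ i : Fin 3, i ≠ 1 →
      dimD L (insert (y i) (range a')) = dimD L (range a') + 1 →
      h.dim (locus L a' y) = h.dim (locus L a' (fun _ : Fin 1 => y i)) + sInf S := by
    intro i hi hyi
    have hr : range (y ∘ ![i, 1]) ∪ range a' = insert (y 1) (insert (y i) (range a')) := by
      ext x
      simp [Fin.exists_fin_two, eq_comm, or_assoc, or_left_comm]
    have hfin' := (hCf.insert (y i)).insert (y 1)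
    have h2 := hy2 1 i hi.symm
    have h3 : dimD L (insert (y 1) (insert (y i) (range a'))) ≤ dimD L (range y ∪ range a') :=
      hr ▸ dimD_mono hC ((finite_range y).union hCf)
        (union_subset_union_left _ (range_comp_subset_range _ _))
    rw [h.dim_locus_comp_eq hf hM hfin (by norm_num) (by norm_num) a' y ![i, 1]
      (by rw [hr]; omega),
      h.dim_locus_add hfin two_pos one_pos one_pos a' (y ∘ ![i, 1]) (fun _ => 0) (fun _ => 1)
        (by intro k; fin_cases k <;> simp)]
    congr 1
    refine le_antisymm ?_ (hmin _ _ ?_)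
    · have hle := h.dim_locus_le_of_comp hfin one_pos
        (Fin.append a' ((y ∘ ![i, 1]) ∘ fun _ : Fin 1 => 0)) (Fin.castAdd 1)
        ((y ∘ ![i, 1]) ∘ fun _ : Fin 1 => 1)
      refine hle.trans (le_of_eq ?_)
      have h4 : Fin.append a' ((y ∘ ![i, 1]) ∘ fun _ : Fin 1 => 0) ∘ Fin.castAdd 1 = a' := by
        funext k
        simp
      rw [h4, ← hab', ← hyb]
      rfl
    · rw [range_append, hrange, union_comm, hrange]
      change dimD L (insert (y 1) (insert (y i) (range a'))) =
        dimD L (insert (y i) (range a')) + 1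
      omega
  have hstep : ∀ i j : Fin 3, i ≠ j →
      dimD L (insert (y i) (range a')) = dimD L (range a') + 1 := by
    intro i j hij
    have h1 := hy2 j i hij.symm
    have h2 := dimD_insert_le hC (hCf.insert (y i)) (y j)
    have h3 := dimD_insert_le hC hCf (y i)
    omega
  -- The two computations of the dimension of the triple give twice the minimum, and the minimum
  -- plus the dimension of the locus of `z`.
  have e1 := hpair 0 (by decide) (hstep 0 1 (by decide))
  have e2 := hpair 2 (by decide) (hstep 2 1 (by decide))
  rw [hy0, hab'] at e1
  rw [hyz] at e2
  omega

lemma dim_locus_one (hrel : L.IsRelational) (R : L.Relations 3)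
    (hf' : ∀ x : ℝ, 0 ≤ x → derivWithin f (Set.Ioi x) x ≤ 1 / (2 * (x + 1)))
    {m : ℕ} (a : Fin m → M) (b : Fin 1 → M) :
    (h.dim (locus L a b) : ℤ) =
      h.dim (univ : Set (Fin 1 → M)) * relDimD L (range b) (range a) := by
  have hC : ∀ X : Set M, X.Finite → InClass L f X := fun _ hX => hM.inClass_of_finite hX
  have hr : range b ∪ range a = insert (b 0) (range a) := by
    rw [range_unique]
    rfl
  have h1 := dimD_insert_le hC (finite_range a) (b 0)
  have h2 := dimD_mono hC ((finite_range a).insert (b 0)) (subset_insert _ _)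
  rcases (by omega : dimD L (insert (b 0) (range a)) = dimD L (range a) ∨
    dimD L (insert (b 0) (range a)) = dimD L (range a) + 1) with h3 | h3
  · rw [h.dim_locus_eq_zero hf hM hfin one_pos a b (hr ▸ h3), relDimD, hr, h3]
    simp
  · rw [h.dim_locus_eq_dim_univ hf hM hfin hrel R hf' a b (hr ▸ h3), relDimD, hr, h3]
    simp

/-- Both sides are additive when the last coordinate is split off, which reduces the claim to single
points. -/
lemma dim_locus_eq_mul (hrel : L.IsRelational) (R : L.Relations 3)
    (hf' : ∀ x : ℝ, 0 ≤ x → derivWithin f (Set.Ioi x) x ≤ 1 / (2 * (x + 1)))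
    {m : ℕ} (a : Fin m → M) (n : ℕ) (b : Fin (n + 1) → M) :
    (h.dim (locus L a b) : ℤ) =
      h.dim (univ : Set (Fin 1 → M)) * relDimD L (range b) (range a) := by
  induction n with
  | zero => exact h.dim_locus_one hf hM hfin hrel R hf' a b
  | succ n ih =>
    rw [h.dim_locus_add hfin (Nat.succ_pos _) (Nat.succ_pos _) one_pos a b Fin.castSucc
      (fun _ => Fin.last _) fun k => ?_, Nat.cast_add, ih,
      h.dim_locus_one hf hM hfin hrel R hf', ← mul_add]
    · congr 1
      have h1 : range (b ∘ fun _ : Fin 1 => Fin.last (n + 1)) ∪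
          (range a ∪ range (b ∘ Fin.castSucc)) = range b ∪ range a := by
        ext x
        simp only [mem_union, mem_range, Fin.exists_fin_succ', Function.comp_apply]
        tauto
      rw [relDimD, relDimD, relDimD, range_append, h1, union_comm (range a)]
      ring
    · refine Fin.lastCases (Or.inr ⟨0, rfl⟩) (fun i => Or.inl ⟨i, rfl⟩) k

end DimensionMeasure

end Rank

end MSHrushovski

theorem theorem4p3 {L : FirstOrder.Language} [Fintype (Σ n, L.Relations n)]
    (hrel : L.IsRelational) (hnullary : IsEmpty (L.Relations 0))
    (hternary : Nonempty (L.Relations 3))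
    {f : ℝ → ℝ} (hf : MSHrushovski.GoodFunction f)
    (hf' : ∀ x : ℝ, 0 ≤ x → derivWithin f (Set.Ioi x) x ≤ 1 / (2 * (x + 1)))
    {M : Type*} [L.Structure M] (hM : MSHrushovski.IsGeneric L f M)
    (h : MSHrushovski.DimensionMeasure L M)
    {m n : ℕ} (hn : 0 < n) (a : Fin m → M) (b : Fin n → M) :
    (h.dim (MSHrushovski.locus L a b) : ℤ) =
      (h.dim (Set.univ : Set (Fin 1 → M)) : ℤ) *
        MSHrushovski.relDimD L (Set.range b) (Set.range a) := by
  obtain ⟨n, rfl⟩ := Nat.exists_eq_succ_of_ne_zero hn.ne'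
  obtain ⟨R⟩ := hternary
  exact h.dim_locus_eq_mul hf hM (hM.finitelyManyTypes hrel hf) hrel R hf' a n b
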